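/- There is an absolute constant $c>0$ such that the following holds. Let $n\ge 0$, $d\ge 1$ be integers and let $0<\varepsilon\le\alpha\le 1$ be such that $\varepsilon n$ is an integer, $$n\ \ge\ \frac{\sqrt d}{\alpha^2}+\frac{d\varepsilon^3}{\alpha^4}\qquad\text{and}\qquad n\ \le\ c\cdot\min\left(\frac{d^{2/3}\varepsilon^{2/3}}{\alpha^{8/3}},\ \frac{d\varepsilon}{\alpha^2}\right).$$ Let $\mathcal D_0=N(0,I_d)^{\otimes n}$, and let $\mathcal D_1$ be the law of $(X_1,\dots,X_n)\in(\mathbb R^d)^n$ generated as follows, with $\beta=\frac1n\left(1-\sqrt{1-\frac{\alpha^2 n}{d\varepsilon}}\right)$: choose $A\subset\{1,\dots,n\}$ with $|A|=\varepsilon n$ uniformly at random; draw $X_i\sim N(0,I_d)$ i.i.d. for $i\in A$; draw $z\sim N\left(0,\frac{\alpha^2}{d}I_d\right)$ independently; put $\mu=-\beta\sum_{i\in A}X_i-z$; and draw $X_i\sim N(\mu,I_d)$ i.i.d. for $i\notin A$. Then $$d_{\mathrm{TV}}(\mathcal D_0,\mathcal D_1)=\sup_{S}|\mathcal D_0(S)-\mathcal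 D_1(S)|\le 0.1 .$$ Moreover, there is no mean tester with $n$ samples that is robust to oblivious $\varepsilon$-contamination with success probability $2/3$; that is, there is no (possibly randomized) test such that, for every set $A$ of $\varepsilon n$ indices and all values $(y_i)_{i\in A}$ fixed in advance, if $n$ i.i.d. samples from $N(\mu,I_d)$ are drawn and those with index in $A$ are replaced by the $y_i$, then the test accepts with probability at least $2/3$ when $\mu=0$ and rejects with probability at least $2/3$ whenever $\alpha\le\|\mu\|_2\le 2\alpha$. -/

import Mathlib

open MeasureTheory ProbabilityTheory

noncomputable section

namespace ObliviousMeanTesting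

/-- Total variation distance between two (probability) measures:
the supremum over all events of the difference of their probabilities. -/
def tvDist {Ω : Type*} [MeasurableSpace Ω] (P Q : Measure Ω) : ℝ :=
  ⨆ s : {s : Set Ω // MeasurableSet s}, |P.real s.1 - Q.real s.1|

/-- A dataset of `n` points of `ℝ^d`. -/
abbrev Sample (n d : ℕ) : Type := Fin n → EuclideanSpace ℝ (Fin d)

/-- The law of `n` i.i.d. samples from `N(μ, I)` in `ℝ^d`. -/
def iidGaussian (n : ℕ) {d : ℕ} (μ : EuclideanSpace ℝ (Fin d)) : Measure (Sample n d) :=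
  Measure.pi fun _ => multivariateGaussian μ (1 : Matrix (Fin d) (Fin d) ℝ)

/-- The null distribution `N(0, I)^{⊗ n}`. -/
def nullLaw (n d : ℕ) : Measure (Sample n d) := iidGaussian n 0

/-- The dataset obtained from Gaussian noise `g`, a corrupted index set `A` and a vector `z`:
the points with index in `A` are the `g i` themselves, the mean is
`μ = -β • ∑ j ∈ A, g j - z`, and the points with index outside `A` are `μ + g i`. -/
def plant {n d : ℕ} (β : ℝ) (A : Finset (Fin n)) (g : Sample n d)
    (z : EuclideanSpace ℝ (Fin d)) : Sample n d :=
  fun i => if i ∈ A then g i else (-(β • ∑ j ∈ A, g j) - z) + g i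

/-- The alternative distribution given the corrupted index set `A`: the points `X i`, `i ∈ A`, are
i.i.d. `N(0, I)`; then `z ∼ N(0, (α² / d) I)` is drawn independently, and given these the remaining
points are i.i.d. `N(μ, I)` with `μ = -β • ∑ j ∈ A, X j - z`
(each of them is `μ` plus an independent standard Gaussian). -/
def altLawGiven (n d : ℕ) (α β : ℝ) (A : Finset (Fin n)) : Measure (Sample n d) :=
  ((nullLaw n d).prod
    (multivariateGaussian (0 : EuclideanSpace ℝ (Fin d))
      ((α ^ 2 / (d : ℝ)) • (1 : Matrix (Fin d) (Fin d) ℝ)))).map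
    fun p => plant β A p.1 p.2

/-- The alternative distribution: `A` is a uniformly random subset of the `n` indices of
size `k`, and the dataset is then drawn from `altLawGiven n d α β A`. -/
def altLaw (n d k : ℕ) (α β : ℝ) : Measure (Sample n d) :=
  ((n.choose k : ENNReal)⁻¹) •
    ∑ A ∈ Finset.powersetCard k (Finset.univ : Finset (Fin n)), altLawGiven n d α β A

/-- The value of the correlation parameter used by the adversary,
`β = (1 / n) (1 - √(1 - α² n / (d ε)))`. -/
def correlation (n d : ℕ) (ε α : ℝ) : ℝ :=
  (1 / (n : ℝ)) * (1 - Real.sqrt (1 - α ^ 2 * (n : ℝ) / ((d : ℝ) * ε)))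

/-- The law of the dataset seen by the algorithm under oblivious contamination: the adversary
fixes the corrupted indices `A` and the values `y` (only the `y i` with `i ∈ A` matter); then `n`
i.i.d. samples from `N(μ, I)` are drawn, and those with index in `A` are replaced. -/
def contaminatedLaw {n d : ℕ} (A : Finset (Fin n)) (y : Sample n d)
    (μ : EuclideanSpace ℝ (Fin d)) : Measure (Sample n d) :=
  (iidGaussian n μ).map fun x i => if i ∈ A then y i else x i

/-- `φ` is a (randomized) mean tester in `ℝ^d` with `n` samples, robust to the oblivious
contamination of `k` of them, for distance `α` and with success probability at least `p`.
Here `φ x ∈ [0, 1]` is the probability that the tester rejects the hypothesis `μ = 0` on the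
dataset `x`. Under every choice of the oblivious adversary it must accept with probability at
least `p` if the mean is `0`, and reject with probability at least `p` if the mean `μ`
satisfies `α ≤ ‖μ‖ ≤ 2 α`. -/
structure IsRobustMeanTester (n d k : ℕ) (α p : ℝ) (φ : Sample n d → ℝ) : Prop where
  measurable : Measurable φ
  nonneg : ∀ x, 0 ≤ φ x
  le_one : ∀ x, φ x ≤ 1
  accept : ∀ (A : Finset (Fin n)) (y : Sample n d), A.card = k →
    p ≤ ∫ x, (1 - φ x) ∂(contaminatedLaw A y 0)
  reject : ∀ (A : Finset (Fin n)) (y : Sample n d) (μ : EuclideanSpace ℝ (Fin d)), A.card = k →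
    α ≤ ‖μ‖ → ‖μ‖ ≤ 2 * α → p ≤ ∫ x, φ x ∂(contaminatedLaw A y μ)

end ObliviousMeanTesting

end

/-!
Reading the dataset coordinate by coordinate, the null law is a product of `d` copies of `N(0, I_n)`
and, given the corrupted set `A`, the planted law is a product of `d` copies of `N(0, I_n + E_A)`,
where `E_A` (`covDeviation`) has rank two and is constant on the four blocks cut out by `A` and its
complement. The value of `β` solves `β² ε n + α² / d = 2 β ε`, so that the bottom block of `E_A`
equals `2 β ε`; this almost cancels the average of `E_A` over `A`.

The second moment of the planted likelihood ratio is the average over two independent sets of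
`det (I - E_A E_A')^(-d / 2)` (`integral_gaussianRatio_mul`). By the Weinstein–Aronszajn identity
the determinant is `2 × 2`, and it depends only on `t = |A ∩ A'| - ε² n`: it is `1 - τ` plus a
square, with `τ ≤ β² (4 n² ε⁴ + 18 n |t|)` (`det_one_sub_covDeviation_mul`,
`HardRegime.inv_sqrt_det_pow_le`). The overlap has exponential moments at most those of a
binomial variable (`subsetAvg_pow_card_inter_le`), which gives those of `|t|`
(`subsetAvg_exp_abs_overlap_le`). In the given range of parameters `1 ≪ ε √n`, `ε² √n ≪ 1` and
`d β² n · ε √n ≪ 1` (`HardRegime.scales`), so the second moment is at most `1.01` and no test with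
values in `[0, 1]` has advantage more than `1 / 10` (`HardRegime.abs_integral_altLaw_sub_le`).

For the testing lower bound, the planted law is a mixture of contaminated laws with mean
`-β ∑ j ∈ A, X j - z ∼ N(0, 2 β ε I_d)` (`integral_altLawGiven_eq`). The squared norm of this mean
is concentrated around `2 β ε d`, which exceeds the square of the scale used in the construction only
slightly. With scale `α` about half of the mass would have norm below `α`; the construction is
therefore run with scale `√2 α`, for which the norm lies in `[α, 2 α]` with probability at least
`4 / 5` (`HardRegime.prob_norm_plantMean_mem`). A tester would then reject under the planted law
with probability at least `8 / 15`, and under the null law with probability at most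
`1 / 3 < 8 / 15 - 1 / 10`.
-/

noncomputable section

namespace ObliviousMeanTesting

open Matrix

/-! ### Gaussian vectors and their likelihood ratios -/

/-- The standard Gaussian measure on `ι → ℝ`, the law of independent `N(0, 1)` coordinates. -/
def stdGaussianPi (ι : Type*) [Fintype ι] : Measure (ι → ℝ) :=
  Measure.pi fun _ => gaussianReal 0 1

section Gaussian

variable {ι : Type*} [Fintype ι]

instance : IsProbabilityMeasure (stdGaussianPi ι) := by
  unfold stdGaussianPi; infer_instance

/-- A product of measures with densities has the product of the densities as density. -/
lemma pi_withDensity_ofReal {κ E : Type*} [Fintype κ] [MeasurableSpace E] (μ : Measure E)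
    [SigmaFinite μ] {f : E → ℝ} (hf : Integrable f μ) (h0 : ∀ x, 0 ≤ f x) :
    (Measure.pi fun _ : κ => μ.withDensity fun x => ENNReal.ofReal (f x)) =
      (Measure.pi fun _ : κ => μ).withDensity fun x => ENNReal.ofReal (∏ i, f (x i)) := by
  have : IsFiniteMeasure (μ.withDensity fun x => ENNReal.ofReal (f x)) :=
    isFiniteMeasure_withDensity_ofReal hf.2
  refine Measure.pi_eq fun s hs => ?_
  have hF : Integrable (fun x : κ → E => ∏ i, f (x i)) (Measure.pi fun _ : κ => μ) :=
    Integrable.fintype_prod (μ := fun _ : κ => μ) (f := fun _ => f) fun _ => hf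
  have hms : MeasurableSet (Set.univ.pi s) := MeasurableSet.univ_pi hs
  rw [withDensity_apply _ hms, ← ofReal_integral_eq_lintegral_ofReal hF.integrableOn
    (ae_of_all _ fun x => Finset.prod_nonneg fun i _ => h0 _)]
  have : ∀ i, (μ.withDensity fun x => ENNReal.ofReal (f x)) (s i)
      = ENNReal.ofReal (∫ x, (s i).indicator f x ∂μ) := fun i => by
    rw [withDensity_apply _ (hs i), ← ofReal_integral_eq_lintegral_ofReal hf.integrableOn
      (ae_of_all _ h0), integral_indicator (hs i)]
  simp_rw [this]
  rw [← ENNReal.ofReal_prod_of_nonneg fun i _ =>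
    integral_nonneg fun x => Set.indicator_nonneg (fun y _ => h0 y) x,
    ← integral_fintype_prod_eq_prod (fun i => (s i).indicator f) (μ := fun _ : κ => μ),
    ← integral_indicator hms]
  congr 1
  refine integral_congr_ae (ae_of_all _ fun x => ?_)
  by_cases hx : x ∈ Set.univ.pi s
  · simp only [Set.indicator_of_mem hx]
    exact Finset.prod_congr rfl fun i _ => (Set.indicator_of_mem (hx i trivial) _).symm
  · simp only [Set.indicator_of_notMem hx]
    obtain ⟨i, hi⟩ : ∃ i, x i ∉ s i := by simpa [Set.mem_pi] using hx
    exact (Finset.prod_eq_zero (Finset.mem_univ i) (Set.indicator_of_notMem hi _)).symm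

/-- The Lebesgue density of the standard Gaussian measure. -/
lemma stdGaussianPi_eq_withDensity :
    stdGaussianPi ι = (volume : Measure (ι → ℝ)).withDensity fun x =>
      ENNReal.ofReal ((√(2 * Real.pi))⁻¹ ^ Fintype.card ι * Real.exp (-(x ⬝ᵥ x) / 2)) := by
  unfold stdGaussianPi
  rw [gaussianReal_of_var_ne_zero 0 one_ne_zero, gaussianPDF_def,
    pi_withDensity_ofReal volume (integrable_gaussianPDFReal 0 1) (gaussianPDFReal_nonneg 0 1)]
  congr 1
  ext x
  congr 1
  simp only [gaussianPDFReal, Finset.prod_mul_distrib, Finset.prod_const, Finset.card_univ]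
  rw [← Real.exp_sum]
  simp [dotProduct, Finset.sum_neg_distrib, Finset.sum_div, neg_div, sq]

variable [DecidableEq ι]

/-- The density of a centred Gaussian vector `T g` with respect to the standard Gaussian
measure. -/
lemma map_mulVec_stdGaussianPi (T : Matrix ι ι ℝ) (hT : T.det ≠ 0) :
    (stdGaussianPi ι).map (T *ᵥ ·) = (stdGaussianPi ι).withDensity fun x =>
      ENNReal.ofReal (|T.det|⁻¹ *
        Real.exp ((x ⬝ᵥ x - (T⁻¹ *ᵥ x) ⬝ᵥ (T⁻¹ *ᵥ x)) / 2)) := by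
  have hU : IsUnit T.det := hT.isUnit
  have hm : Measurable (fun x : ι → ℝ => T *ᵥ x) := by fun_prop
  ext s hs
  rw [Measure.map_apply hm hs, stdGaussianPi_eq_withDensity, withDensity_apply _ (hm hs),
    ← withDensity_mul _ (by fun_prop) (by fun_prop), withDensity_apply _ hs]
  have hvol := Real.map_matrix_volume_pi_eq_smul_volume_pi hT
  have hm' : Measurable (Matrix.toLin' T) := hm
  have h1 : ∫⁻ x in s, ENNReal.ofReal ((√(2 * Real.pi))⁻¹ ^ Fintype.card ι *
        Real.exp (-((T⁻¹ *ᵥ x) ⬝ᵥ (T⁻¹ *ᵥ x)) / 2)) ∂(volume.map (Matrix.toLin' T))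
      = ∫⁻ x in (fun x : ι → ℝ => T *ᵥ x) ⁻¹' s,
        ENNReal.ofReal ((√(2 * Real.pi))⁻¹ ^ Fintype.card ι * Real.exp (-(x ⬝ᵥ x) / 2)) := by
    rw [setLIntegral_map hs (by fun_prop) hm']
    simp only [Matrix.toLin'_apply, Matrix.mulVec_mulVec, Matrix.nonsing_inv_mul _ hU,
      Matrix.one_mulVec]
    rfl
  rw [← h1, hvol, Measure.restrict_smul, lintegral_smul_measure, smul_eq_mul,
    ← lintegral_const_mul _ (by fun_prop)]
  refine lintegral_congr fun x => ?_
  simp only [Pi.mul_apply]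
  rw [← ENNReal.ofReal_mul (by positivity), ← ENNReal.ofReal_mul (by positivity), abs_inv]
  congr 1
  rw [mul_mul_mul_comm, mul_comm _ (|T.det|⁻¹), ← Real.exp_add, mul_assoc]
  congr 3
  ring

/-- A positive definite matrix has an invertible square root. -/
lemma exists_mul_transpose_eq {S : Matrix ι ι ℝ} (hS : S.PosDef) :
    ∃ T : Matrix ι ι ℝ, T * Tᵀ = S ∧ |T.det| = √S.det ∧ T.det ≠ 0 := by
  obtain ⟨B, hB⟩ : ∃ B : Matrix ι ι ℝ, S = Bᴴ * B := by
    open scoped MatrixOrder in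
    exact CStarAlgebra.nonneg_iff_eq_star_mul_self.mp hS.posSemidef.nonneg
  refine ⟨Bᵀ, by simpa using hB.symm, ?_⟩
  have hd : S.det = B.det * B.det := by simp [hB]
  refine ⟨by rw [hd, Real.sqrt_mul_self_eq_abs, det_transpose], fun h => ?_⟩
  rw [det_transpose] at h
  have := hS.det_pos
  simp [hd, h] at this

/-- The likelihood ratio of the centred Gaussian law with covariance `S` against the standard
one. -/
def gaussianRatio (S : Matrix ι ι ℝ) (x : ι → ℝ) : ℝ :=
  (√S.det)⁻¹ * Real.exp ((x ⬝ᵥ x - x ⬝ᵥ (S⁻¹ *ᵥ x)) / 2)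

lemma measurable_gaussianRatio (S : Matrix ι ι ℝ) : Measurable (gaussianRatio S) := by
  unfold gaussianRatio; fun_prop

lemma gaussianRatio_nonneg (S : Matrix ι ι ℝ) (x : ι → ℝ) : 0 ≤ gaussianRatio S x := by
  unfold gaussianRatio; positivity

lemma map_mulVec_eq_withDensity_gaussianRatio {T S : Matrix ι ι ℝ} (hT : T * Tᵀ = S)
    (hd : |T.det| = √S.det) (h0 : T.det ≠ 0) :
    (stdGaussianPi ι).map (T *ᵥ ·) =
      (stdGaussianPi ι).withDensity fun x => ENNReal.ofReal (gaussianRatio S x) := by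
  rw [map_mulVec_stdGaussianPi T h0]
  congr 1
  ext x
  rw [gaussianRatio, hd, ← hT, Matrix.mul_inv_rev, ← Matrix.mulVec_mulVec, dotProduct_mulVec x,
    ← Matrix.transpose_nonsing_inv, vecMul_transpose]

lemma integrable_gaussianRatio {S : Matrix ι ι ℝ} (hS : S.PosDef) :
    Integrable (gaussianRatio S) (stdGaussianPi ι) ∧
      ∫ x, gaussianRatio S x ∂(stdGaussianPi ι) = 1 := by
  obtain ⟨T, hT, hd, h0⟩ := exists_mul_transpose_eq hS
  have h := map_mulVec_eq_withDensity_gaussianRatio hT hd h0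
  have hm : Measurable (fun x : ι → ℝ => T *ᵥ x) := by fun_prop
  have := Measure.isProbabilityMeasure_map (μ := stdGaussianPi ι) hm.aemeasurable
  have h1 : ∫⁻ x, ENNReal.ofReal (gaussianRatio S x) ∂(stdGaussianPi ι) = 1 := by
    rw [← setLIntegral_univ, ← withDensity_apply _ MeasurableSet.univ, ← h, measure_univ]
  have hi : Integrable (gaussianRatio S) (stdGaussianPi ι) := by
    refine ⟨(measurable_gaussianRatio S).aestronglyMeasurable, ?_⟩
    rw [hasFiniteIntegral_iff_ofReal (ae_of_all _ (gaussianRatio_nonneg S)), h1]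
    exact ENNReal.one_lt_top
  refine ⟨hi, ?_⟩
  rw [integral_eq_lintegral_of_nonneg_ae (ae_of_all _ (gaussianRatio_nonneg S))
    hi.1, h1, ENNReal.toReal_one]

/-- The Gaussian integral `E exp ((|x|² - xᵀ N x) / 2) = (det N)^(-1/2)`. -/
lemma integral_exp_quadratic {N : Matrix ι ι ℝ} (hN : N.PosDef) :
    Integrable (fun x => Real.exp ((x ⬝ᵥ x - x ⬝ᵥ (N *ᵥ x)) / 2)) (stdGaussianPi ι) ∧
      ∫ x, Real.exp ((x ⬝ᵥ x - x ⬝ᵥ (N *ᵥ x)) / 2) ∂(stdGaussianPi ι) = (√N.det)⁻¹ := by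
  have hp : 0 < √N⁻¹.det := Real.sqrt_pos.mpr hN.inv.det_pos
  have hinv : N⁻¹⁻¹ = N := Matrix.nonsing_inv_nonsing_inv _ hN.det_pos.ne'.isUnit
  have hfun : (fun x => Real.exp ((x ⬝ᵥ x - x ⬝ᵥ (N *ᵥ x)) / 2)) =
      fun x => √N⁻¹.det * gaussianRatio N⁻¹ x := by
    ext x
    rw [gaussianRatio, hinv, mul_inv_cancel_left₀ hp.ne']
  obtain ⟨h1, h2⟩ := integrable_gaussianRatio hN.inv
  rw [hfun]
  refine ⟨h1.const_mul _, ?_⟩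
  rw [integral_const_mul, h2, mul_one, det_nonsing_inv, Ring.inverse_eq_inv', Real.sqrt_inv]

/-- The correlation of two Gaussian likelihood ratios is `det (I - E E')^(-1/2)` where `E`, `E'`
are the deviations of the covariances from the identity. -/
lemma integral_gaussianRatio_mul {S S' : Matrix ι ι ℝ} (hS : S.PosDef) (hS' : S'.PosDef)
    (hN : (S⁻¹ + S'⁻¹ - 1).PosDef) :
    Integrable (fun x => gaussianRatio S x * gaussianRatio S' x) (stdGaussianPi ι) ∧
      ∫ x, gaussianRatio S x * gaussianRatio S' x ∂(stdGaussianPi ι) =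
        (√(1 - (S - 1) * (S' - 1)).det)⁻¹ := by
  have hfun : (fun x => gaussianRatio S x * gaussianRatio S' x) = fun x =>
      (√S.det * √S'.det)⁻¹ * Real.exp ((x ⬝ᵥ x - x ⬝ᵥ ((S⁻¹ + S'⁻¹ - 1) *ᵥ x)) / 2) := by
    ext x
    rw [gaussianRatio, gaussianRatio, mul_mul_mul_comm, ← mul_inv, ← Real.exp_add, sub_mulVec,
      add_mulVec, dotProduct_sub, dotProduct_add, one_mulVec]
    congr 2
    ring
  obtain ⟨h1, h2⟩ := integral_exp_quadratic hN
  rw [hfun]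
  refine ⟨h1.const_mul _, ?_⟩
  have hmat : 1 - (S - 1) * (S' - 1) = S * (S⁻¹ + S'⁻¹ - 1) * S' := by
    have e1 : S * S⁻¹ = 1 := mul_nonsing_inv _ hS.det_pos.ne'.isUnit
    have e2 : S'⁻¹ * S' = 1 := nonsing_inv_mul _ hS'.det_pos.ne'.isUnit
    calc 1 - (S - 1) * (S' - 1) = 1 * S' + S * 1 - S * S' := by noncomm_ring
      _ = _ := by
        conv_lhs => rw [← e1]
        rw [Matrix.mul_sub, Matrix.mul_add, Matrix.sub_mul, Matrix.add_mul, Matrix.mul_assoc S S'⁻¹,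
          e2, e1, Matrix.mul_one]
  rw [integral_const_mul, h2, hmat, det_mul, det_mul, Real.sqrt_mul (by
    exact mul_nonneg hS.det_pos.le hN.det_pos.le), Real.sqrt_mul hS.det_pos.le, ← mul_inv]
  congr 1
  ring

open Complex in
lemma charFunDual_gaussianReal (L : StrongDual ℝ ℝ) :
    charFunDual (gaussianReal 0 1) L = cexp (-((L 1 : ℝ) : ℂ) ^ 2 / 2) := by
  rw [charFunDual_eq_charFun_map_one]
  have : (L : ℝ → ℝ) = fun x => L 1 * x := by
    ext x
    rw [mul_comm, ← smul_eq_mul, ← map_smul, smul_eq_mul, mul_one]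
  rw [this, gaussianReal_map_const_mul, charFun_gaussianReal]
  simp [neg_div]

open Complex in
lemma charFunDual_stdGaussianPi (L : StrongDual ℝ (ι → ℝ)) :
    charFunDual (stdGaussianPi ι) L = cexp (-((∑ i, L (Pi.single i 1) ^ 2 : ℝ) : ℂ) / 2) := by
  unfold stdGaussianPi
  rw [charFunDual_pi]
  simp_rw [charFunDual_gaussianReal, ← Complex.exp_sum]
  congr 1
  push_cast
  simp [Finset.sum_neg_distrib, Finset.sum_div, neg_div]

end Gaussian

/-! ### One coordinate of the planted dataset -/

section Row

variable {ι : Type*} [DecidableEq ι]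

/-- The `ι × 2` matrix whose columns are the indicators of `A` and of its complement. -/
def cellMatrix (A : Finset ι) : Matrix ι (Fin 2) ℝ :=
  Matrix.of fun i => ![if i ∈ A then 1 else 0, if i ∈ A then 0 else 1]

/-- The entries of `Cov - I` on the blocks `A × A`, `A × Aᶜ`, `Aᶜ × A`, `Aᶜ × Aᶜ`. -/
def blockMatrix (β γ : ℝ) : Matrix (Fin 2) (Fin 2) ℝ := !![0, -β; -β, γ]

/-- The deviation from the identity of the covariance of a coordinate of the planted dataset, with
cross-covariance `-β` and with `γ` on `Aᶜ × Aᶜ`. -/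
def covDeviation (β γ : ℝ) (A : Finset ι) : Matrix ι ι ℝ :=
  cellMatrix A * blockMatrix β γ * (cellMatrix A)ᵀ

/-- The covariance of a coordinate of the planted dataset. -/
def plantCov (β γ : ℝ) (A : Finset ι) : Matrix ι ι ℝ := 1 + covDeviation β γ A

/-- A single coordinate of the planted dataset, as a function of the noise `p.1` and of the
normalised coordinate `p.2` of the random shift, whose standard deviation is `w`. -/
def plantRow (β w : ℝ) (A : Finset ι) (p : (ι → ℝ) × ℝ) : ι → ℝ :=
  fun i => if i ∈ A then p.1 i else (-(β * ∑ j ∈ A, p.1 j) - w * p.2) + p.1 i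

lemma covDeviation_isSymm (β γ : ℝ) (A : Finset ι) :
    (covDeviation β γ A)ᵀ = covDeviation β γ A := by
  have : (blockMatrix β γ)ᵀ = blockMatrix β γ := by
    ext i j; fin_cases i <;> fin_cases j <;> rfl
  rw [covDeviation, transpose_mul, transpose_mul, transpose_transpose, this, Matrix.mul_assoc]

lemma plantCov_isSymm (β γ : ℝ) (A : Finset ι) : (plantCov β γ A)ᵀ = plantCov β γ A := by
  rw [plantCov, transpose_add, covDeviation_isSymm, transpose_one]

lemma measurable_plantRow (β w : ℝ) (A : Finset ι) : Measurable (plantRow β w A) := by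
  refine measurable_pi_lambda _ fun i => ?_
  unfold plantRow
  split_ifs <;> fun_prop

variable [Fintype ι]

lemma sum_ite_zero_eq_sum_compl (A : Finset ι) (f : ι → ℝ) :
    ∑ i, (if i ∈ A then 0 else f i) = ∑ i ∈ Aᶜ, f i := by
  rw [Finset.sum_ite, Finset.sum_const_zero, zero_add]
  exact Finset.sum_congr (by ext; simp) fun _ _ => rfl

lemma cellMatrix_transpose_mulVec (A : Finset ι) (x : ι → ℝ) :
    (cellMatrix A)ᵀ *ᵥ x = ![∑ i ∈ A, x i, ∑ i ∈ Aᶜ, x i] := by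
  ext l
  fin_cases l
  · simp [cellMatrix, mulVec, dotProduct, Finset.sum_ite_mem]
  · simpa [cellMatrix, mulVec, dotProduct] using sum_ite_zero_eq_sum_compl A x

lemma dotProduct_covDeviation (β γ : ℝ) (A : Finset ι) (x : ι → ℝ) :
    x ⬝ᵥ (covDeviation β γ A *ᵥ x) =
      -(2 * β * (∑ i ∈ A, x i) * ∑ i ∈ Aᶜ, x i) + γ * (∑ i ∈ Aᶜ, x i) ^ 2 := by
  rw [covDeviation, ← mulVec_mulVec, ← mulVec_mulVec, dotProduct_mulVec, ← mulVec_transpose,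
    cellMatrix_transpose_mulVec]
  simp [blockMatrix, mulVec, dotProduct, Fin.sum_univ_two]
  ring

lemma abs_dotProduct_covDeviation_le {β γ : ℝ} (hβ : 0 ≤ β) (hγ : 0 ≤ γ)
    (h : (2 * β + γ) * Fintype.card ι ≤ 1 / 2) (A : Finset ι) (x : ι → ℝ) :
    |x ⬝ᵥ (covDeviation β γ A *ᵥ x)| ≤ 1 / 2 * (x ⬝ᵥ x) := by
  have hcs : ∀ S : Finset ι, (∑ i ∈ S, x i) ^ 2 ≤ Fintype.card ι * (x ⬝ᵥ x) := fun S => by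
    have h1 : (∑ i ∈ S, x i) ^ 2 ≤ S.card * ∑ i ∈ S, x i ^ 2 := sq_sum_le_card_mul_sum_sq
    have h2 : ∑ i ∈ S, x i ^ 2 ≤ x ⬝ᵥ x := by
      simp only [dotProduct, ← sq]
      exact Finset.sum_le_sum_of_subset_of_nonneg (Finset.subset_univ _) fun _ _ _ => sq_nonneg _
    have h3 : (S.card : ℝ) ≤ Fintype.card ι := by exact_mod_cast Finset.card_le_univ S
    have h4 : 0 ≤ ∑ i ∈ S, x i ^ 2 := Finset.sum_nonneg fun _ _ => sq_nonneg _
    exact h1.trans (by gcongr)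
  have hx : 0 ≤ x ⬝ᵥ x := by
    simp only [dotProduct, ← sq]; exact Finset.sum_nonneg fun _ _ => sq_nonneg _
  rw [dotProduct_covDeviation]
  set a := ∑ i ∈ A, x i
  set b := ∑ i ∈ Aᶜ, x i
  have ha := hcs A
  have hb := hcs Aᶜ
  have h1 : |2 * β * a * b| ≤ β * (2 * (Fintype.card ι * (x ⬝ᵥ x))) := by
    rw [show 2 * β * a * b = β * (2 * a * b) by ring, abs_mul, abs_of_nonneg hβ]
    refine mul_le_mul_of_nonneg_left (abs_le.mpr ⟨?_, ?_⟩) hβ <;>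
      nlinarith [sq_nonneg (a - b), sq_nonneg (a + b)]
  have h2 : |γ * b ^ 2| ≤ γ * (Fintype.card ι * (x ⬝ᵥ x)) := by
    rw [abs_of_nonneg (by positivity)]; gcongr
  calc _ ≤ |2 * β * a * b| + |γ * b ^ 2| := by
        rw [← abs_neg (2 * β * a * b)]; exact abs_add_le _ _
    _ ≤ ((2 * β + γ) * Fintype.card ι) * (x ⬝ᵥ x) := by linarith
    _ ≤ _ := by gcongr

lemma posDef_plantCov {β γ : ℝ} (hβ : 0 ≤ β) (hγ : 0 ≤ γ)
    (h : (2 * β + γ) * Fintype.card ι ≤ 1 / 2) (A : Finset ι) : (plantCov β γ A).PosDef := by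
  refine .of_dotProduct_mulVec_pos ?_ fun {x} hx => ?_
  · rw [IsHermitian, conjTranspose_eq_transpose_of_trivial, plantCov_isSymm]
  · have hx' : 0 < x ⬝ᵥ x := by
      simpa using dotProduct_star_self_pos_iff.mpr hx
    have := abs_le.mp (abs_dotProduct_covDeviation_le hβ hγ h A x)
    rw [star_trivial, plantCov, add_mulVec, dotProduct_add, one_mulVec]
    linarith

lemma dotProduct_inv_plantCov_ge {β γ : ℝ} (hβ : 0 ≤ β) (hγ : 0 ≤ γ)
    (h : (2 * β + γ) * Fintype.card ι ≤ 1 / 2) (A : Finset ι) (x : ι → ℝ) :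
    2 / 3 * (x ⬝ᵥ x) ≤ x ⬝ᵥ ((plantCov β γ A)⁻¹ *ᵥ x) := by
  have hS := posDef_plantCov hβ hγ h A
  set S := plantCov β γ A with hSdef
  have hb : x ⬝ᵥ (S *ᵥ x) ≤ 3 / 2 * (x ⬝ᵥ x) := by
    have := abs_le.mp (abs_dotProduct_covDeviation_le hβ hγ h A x)
    rw [hSdef, plantCov, add_mulVec, dotProduct_add, one_mulVec]
    linarith
  -- expand the nonnegative quadratic form of `S` at `(2 / 3) x - S⁻¹ x`
  have h0 := hS.posSemidef.dotProduct_mulVec_nonneg ((2 / 3 : ℝ) • x - S⁻¹ *ᵥ x)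
  have hSy : S *ᵥ (S⁻¹ *ᵥ x) = x := by
    rw [mulVec_mulVec, mul_nonsing_inv _ hS.det_pos.ne'.isUnit, one_mulVec]
  have hsym : (S⁻¹ *ᵥ x) ⬝ᵥ (S *ᵥ x) = x ⬝ᵥ x := by
    rw [dotProduct_mulVec, ← mulVec_transpose, hSdef, plantCov_isSymm, ← hSdef, hSy]
  rw [star_trivial, mulVec_sub, mulVec_smul, hSy, sub_dotProduct, dotProduct_sub, dotProduct_sub,
    smul_dotProduct, smul_dotProduct, dotProduct_smul, dotProduct_smul, hsym,
    dotProduct_comm (S⁻¹ *ᵥ x) x] at h0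
  simp only [smul_eq_mul] at h0
  linarith

/-- The quadratic form in the exponent of a product of two planted likelihood ratios is positive
definite, so the product is integrable. -/
lemma posDef_inv_add_inv_sub_one {β γ : ℝ} (hβ : 0 ≤ β) (hγ : 0 ≤ γ)
    (h : (2 * β + γ) * Fintype.card ι ≤ 1 / 2) (A A' : Finset ι) :
    ((plantCov β γ A)⁻¹ + (plantCov β γ A')⁻¹ - 1).PosDef := by
  refine .of_dotProduct_mulVec_pos ?_ fun {x} hx => ?_
  · exact ((posDef_plantCov hβ hγ h A).inv.isHermitian.add
      (posDef_plantCov hβ hγ h A').inv.isHermitian).sub isHermitian_one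
  · have hx' : 0 < x ⬝ᵥ x := by
      simpa using dotProduct_star_self_pos_iff.mpr hx
    have h1 := dotProduct_inv_plantCov_ge hβ hγ h A x
    have h2 := dotProduct_inv_plantCov_ge hβ hγ h A' x
    rw [star_trivial, sub_mulVec, add_mulVec, dotProduct_sub, dotProduct_add, one_mulVec]
    linarith

open Complex in
lemma map_plantRow_eq_map_mulVec {β γ w : ℝ} {A : Finset ι} (hγ : γ = β ^ 2 * A.card + w ^ 2)
    {T : Matrix ι ι ℝ} (hT : T * Tᵀ = plantCov β γ A) :
    ((stdGaussianPi ι).prod (gaussianReal 0 1)).map (plantRow β w A) =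
      (stdGaussianPi ι).map (T *ᵥ ·) := by
  let R : ((ι → ℝ) × ℝ) →ₗ[ℝ] (ι → ℝ) :=
    { toFun := plantRow β w A
      map_add' := fun p q => by
        ext i
        simp only [plantRow, Prod.fst_add, Prod.snd_add, Pi.add_apply, Finset.sum_add_distrib]
        split_ifs <;> ring
      map_smul' := fun c p => by
        ext i
        simp only [plantRow, Prod.smul_fst, Prod.smul_snd, Pi.smul_apply, smul_eq_mul,
          ← Finset.mul_sum, RingHom.id_apply]
        split_ifs <;> ring }
  have hR : plantRow β w A = R.toContinuousLinearMap := rfl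
  have hT' : (fun x : ι → ℝ => T *ᵥ x) = (Matrix.toLin' T).toContinuousLinearMap := by
    ext x; simp
  rw [hR, hT']
  have := Measure.isProbabilityMeasure_map (μ := (stdGaussianPi ι).prod (gaussianReal 0 1))
    R.toContinuousLinearMap.continuous.measurable.aemeasurable
  have := Measure.isProbabilityMeasure_map (μ := stdGaussianPi ι)
    (Matrix.toLin' T).toContinuousLinearMap.continuous.measurable.aemeasurable
  refine Measure.ext_of_charFunDual (funext fun L => ?_)
  rw [charFunDual_map, charFunDual_map, charFunDual_prod, charFunDual_stdGaussianPi,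
    charFunDual_stdGaussianPi, charFunDual_gaussianReal, ← Complex.exp_add]
  congr 1
  set a : ι → ℝ := fun i => L (Pi.single i 1) with ha
  have hL : ∀ x : ι → ℝ, L x = a ⬝ᵥ x := fun x => by
    conv_lhs => rw [← Finset.univ_sum_single x]
    rw [map_sum]
    refine Finset.sum_congr rfl fun i _ => ?_
    rw [ha, mul_comm, ← smul_eq_mul, ← map_smul]
    congr 1
    ext j
    simp [Pi.single_apply]
  have h1 : ∀ i, (L.comp (R.toContinuousLinearMap)).comp (.inl ℝ (ι → ℝ) ℝ) (Pi.single i 1) =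
      a i - (if i ∈ A then β * ∑ j ∈ Aᶜ, a j else 0) := fun i => by
    change L (plantRow β w A (Pi.single i 1, 0)) = _
    have hs : plantRow β w A (Pi.single i 1, 0) =
        Pi.single i 1 - (if i ∈ A then β else 0) • (fun j => if j ∈ A then 0 else 1) := by
      ext j
      have : ∑ l ∈ A, (Pi.single i 1 : ι → ℝ) l = if i ∈ A then 1 else 0 := by
        simp [Pi.single_apply]
      simp only [plantRow, this, Pi.sub_apply, Pi.smul_apply, smul_eq_mul]
      split_ifs <;> ring
    rw [hs, map_sub, map_smul, hL (fun j => if j ∈ A then 0 else 1)]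
    have : (a ⬝ᵥ fun j => if j ∈ A then (0 : ℝ) else 1) = ∑ j ∈ Aᶜ, a j := by
      simpa [dotProduct] using sum_ite_zero_eq_sum_compl A a
    rw [this, smul_eq_mul, ha]
    split_ifs <;> ring
  have h2 : (L.comp (R.toContinuousLinearMap)).comp (.inr ℝ (ι → ℝ) ℝ) 1 =
      -w * ∑ j ∈ Aᶜ, a j := by
    change L (plantRow β w A (0, 1)) = _
    rw [hL]
    simp [dotProduct, plantRow, Finset.compl_eq_univ_sdiff, Finset.sdiff_eq_filter,
      Finset.sum_filter, Finset.mul_sum, mul_comm]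
  have h3 : ∀ i, (L.comp (Matrix.toLin' T).toContinuousLinearMap) (Pi.single i 1) =
      (Tᵀ *ᵥ a) i := fun i => by
    change L (Matrix.toLin' T (Pi.single i 1)) = _
    rw [hL, Matrix.toLin'_apply, dotProduct_mulVec, mulVec_transpose]
    simp
  have h4 : ∑ i, (Tᵀ *ᵥ a) i ^ 2 = a ⬝ᵥ a + a ⬝ᵥ (covDeviation β γ A *ᵥ a) := by
    have : ∑ i, (Tᵀ *ᵥ a) i ^ 2 = (Tᵀ *ᵥ a) ⬝ᵥ (Tᵀ *ᵥ a) := by simp [dotProduct, sq]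
    rw [this, dotProduct_mulVec, ← mulVec_transpose, transpose_transpose, mulVec_mulVec, hT,
      plantCov, add_mulVec, one_mulVec, add_dotProduct, dotProduct_comm (_ *ᵥ a) a]
  have h5 : ∑ i, (a i - (if i ∈ A then β * ∑ j ∈ Aᶜ, a j else 0)) ^ 2 = a ⬝ᵥ a
      - 2 * (β * ∑ j ∈ Aᶜ, a j) * ∑ i ∈ A, a i + A.card * (β * ∑ j ∈ Aᶜ, a j) ^ 2 := by
    set s := β * ∑ j ∈ Aᶜ, a j
    have : ∀ i, (a i - (if i ∈ A then s else 0)) ^ 2 =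
        a i * a i - 2 * s * (if i ∈ A then a i else 0) + (if i ∈ A then s ^ 2 else 0) := fun i => by
      split_ifs <;> ring
    simp_rw [this, Finset.sum_add_distrib, Finset.sum_sub_distrib, ← Finset.mul_sum,
      Finset.sum_ite_mem, Finset.univ_inter, Finset.sum_const, nsmul_eq_mul, dotProduct]
  simp_rw [h1, h2, h3, h4, h5, dotProduct_covDeviation, hγ]
  push_cast
  ring

/-- The law of a coordinate of the planted dataset has the Gaussian likelihood ratio of its
covariance as density. -/
lemma map_plantRow_eq_withDensity {β γ w : ℝ} {A : Finset ι} (hγ : γ = β ^ 2 * A.card + w ^ 2)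
    (hS : (plantCov β γ A).PosDef) :
    ((stdGaussianPi ι).prod (gaussianReal 0 1)).map (plantRow β w A) =
      (stdGaussianPi ι).withDensity fun x => ENNReal.ofReal (gaussianRatio (plantCov β γ A) x) := by
  obtain ⟨T, hT, hd, h0⟩ := exists_mul_transpose_eq hS
  rw [map_plantRow_eq_map_mulVec hγ hT, map_mulVec_eq_withDensity_gaussianRatio hT hd h0]

lemma cellMatrix_transpose_mul_cellMatrix (A A' : Finset ι) {k : ℕ} (hA : A.card = k)
    (hA' : A'.card = k) :
    (cellMatrix A)ᵀ * cellMatrix A' =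
      !![((A ∩ A').card : ℝ), k - (A ∩ A').card;
        k - (A ∩ A').card, Fintype.card ι - 2 * k + (A ∩ A').card] := by
  have e1 : ∑ i, (if i ∈ A then (1 : ℝ) else 0) = k := by simp [hA]
  have e2 : ∑ i, (if i ∈ A' then (1 : ℝ) else 0) = k := by simp [hA']
  have e3 : ∑ i, (if i ∈ A then (1 : ℝ) else 0) * (if i ∈ A' then 1 else 0) = (A ∩ A').card := by
    have : ∀ i, (if i ∈ A then (1 : ℝ) else 0) * (if i ∈ A' then 1 else 0) =
        if i ∈ A ∩ A' then 1 else 0 := fun i => by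
      by_cases h : i ∈ A <;> by_cases h' : i ∈ A' <;> simp [h, h']
    simp_rw [this, Finset.sum_boole, Finset.filter_mem_eq_inter, Finset.univ_inter]
  have e4 : ∑ _i : ι, (1 : ℝ) = Fintype.card ι := by simp
  have key : ∀ (S : Finset ι) (i : ι), (if i ∈ S then (0 : ℝ) else 1) =
      1 - if i ∈ S then 1 else 0 := fun S i => by split_ifs <;> simp
  ext l m
  fin_cases l <;> fin_cases m
  · simpa [Matrix.mul_apply, cellMatrix] using e3
  · change ∑ i, (if i ∈ A then (1 : ℝ) else 0) * (if i ∈ A' then 0 else 1) = k - (A ∩ A').card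
    simp_rw [key, mul_sub, mul_one, Finset.sum_sub_distrib, e1, e3]
  · change ∑ i, (if i ∈ A then (0 : ℝ) else 1) * (if i ∈ A' then 1 else 0) = k - (A ∩ A').card
    simp_rw [key, sub_mul, one_mul, Finset.sum_sub_distrib, e2, e3]
  · change ∑ i, (if i ∈ A then (0 : ℝ) else 1) * (if i ∈ A' then 0 else 1) =
      Fintype.card ι - 2 * k + (A ∩ A').card
    simp_rw [key, sub_mul, mul_sub, one_mul, mul_one, Finset.sum_sub_distrib, e1, e2, e3, e4]
    ring

/-- The determinant controlling the correlation of two planted likelihoods: up to the nonnegative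
term `(β² (n j - k²))²` it is `1` minus the trace of the product of the deviations. -/
lemma det_one_sub_covDeviation_mul (β γ : ℝ) (A A' : Finset ι) {k : ℕ} (hA : A.card = k)
    (hA' : A'.card = k) {a b c : ℝ} (ha : a = (A ∩ A').card) (hb : b = k - a)
    (hc : c = Fintype.card ι - 2 * k + a) :
    (1 - covDeviation β γ A * covDeviation β γ A').det =
      1 - (2 * β ^ 2 * (a * c + b ^ 2) - 4 * β * γ * b * c + γ ^ 2 * c ^ 2)
        + (β ^ 2 * (a * c - b ^ 2)) ^ 2 := by
  have : covDeviation β γ A * covDeviation β γ A' = cellMatrix A *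
      (blockMatrix β γ * ((cellMatrix A)ᵀ * cellMatrix A') * blockMatrix β γ *
        (cellMatrix A')ᵀ) := by
    simp only [covDeviation, Matrix.mul_assoc]
  rw [this, det_one_sub_mul_comm, Matrix.mul_assoc,
    cellMatrix_transpose_mul_cellMatrix A A' hA hA',
    cellMatrix_transpose_mul_cellMatrix A' A hA' hA, Finset.inter_comm A' A, ← ha, ← hb, ← hc,
    blockMatrix, Matrix.one_fin_two, det_fin_two]
  simp
  ring

end Row

/-! ### Overlaps of random subsets -/

section Overlap

open Finset

variable {ι : Type*} [Fintype ι]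

/-- The average of `f` over the `k`-element subsets of the index set. -/
def subsetAvg (ι : Type*) [Fintype ι] (k : ℕ) (f : Finset ι → ℝ) : ℝ :=
  (((Fintype.card ι).choose k : ℕ) : ℝ)⁻¹ * ∑ A ∈ powersetCard k (univ : Finset ι), f A

lemma subsetAvg_mono {k : ℕ} {f g : Finset ι → ℝ} (h : ∀ A, #A = k → f A ≤ g A) :
    subsetAvg ι k f ≤ subsetAvg ι k g := by
  unfold subsetAvg
  gcongr with A hA
  exact h A (mem_powersetCard.mp hA).2

lemma subsetAvg_const {k : ℕ} (hk : k ≤ Fintype.card ι) (c : ℝ) :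
    subsetAvg ι k (fun _ => c) = c := by
  have hc : ((Fintype.card ι).choose k : ℝ) ≠ 0 := by exact_mod_cast (Nat.choose_pos hk).ne'
  simp [subsetAvg, hc]

lemma subsetAvg_add (k : ℕ) (f g : Finset ι → ℝ) :
    subsetAvg ι k (fun A => f A + g A) = subsetAvg ι k f + subsetAvg ι k g := by
  simp [subsetAvg, sum_add_distrib, mul_add]

lemma subsetAvg_const_mul (k : ℕ) (c : ℝ) (f : Finset ι → ℝ) :
    subsetAvg ι k (fun A => c * f A) = c * subsetAvg ι k f := by
  simp only [subsetAvg, ← mul_sum]; ring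

lemma choose_sub_le (n k m : ℕ) (hkn : k ≤ n) (hm : m ≤ k) :
    ((n - m).choose (k - m) : ℝ) ≤ n.choose k * (k / n : ℝ) ^ m := by
  induction m with
  | zero => simp
  | succ m ih =>
    have ih := ih (by omega)
    have hn : (0 : ℝ) < n := by exact_mod_cast (by omega : 0 < n)
    have hnm : (0 : ℝ) < (n - m : ℕ) := by exact_mod_cast (by omega : 0 < n - m)
    -- passing from `m` to `m + 1` multiplies by `(k - m) / (n - m) ≤ k / n`
    have h1 : ((n - m : ℕ) : ℝ) * ((n - (m + 1)).choose (k - (m + 1)) : ℝ) =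
        ((n - m).choose (k - m) : ℝ) * ((k - m : ℕ) : ℝ) := by
      have := Nat.add_one_mul_choose_eq (n - (m + 1)) (k - (m + 1))
      rw [show n - (m + 1) + 1 = n - m by omega, show k - (m + 1) + 1 = k - m by omega] at this
      exact_mod_cast this
    have h2 : ((k - m : ℕ) : ℝ) * n ≤ k * ((n - m : ℕ) : ℝ) := by
      rw [Nat.cast_sub (by omega), Nat.cast_sub (by omega)]
      have : (k : ℝ) ≤ n := by exact_mod_cast hkn
      nlinarith [(Nat.cast_nonneg m : (0 : ℝ) ≤ m)]
    have h3 : ((n - (m + 1)).choose (k - (m + 1)) : ℝ) =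
        ((n - m).choose (k - m) : ℝ) * (((k - m : ℕ) : ℝ) / ((n - m : ℕ) : ℝ)) := by
      field_simp
      linarith
    rw [h3, pow_succ, ← mul_assoc]
    refine mul_le_mul ih ?_ (by positivity) (by positivity)
    rw [div_le_div_iff₀ hnm hn]
    exact h2

variable [DecidableEq ι]

lemma card_powersetCard_filter_superset {k : ℕ} {T : Finset ι} (hT : T.card ≤ k) :
    #{A ∈ powersetCard k (univ : Finset ι) | T ⊆ A} =
      (Fintype.card ι - T.card).choose (k - T.card) := by
  rw [← card_compl, ← card_powersetCard]
  refine card_bij' (fun A _ => A \ T) (fun B _ => B ∪ T) ?_ ?_ ?_ ?_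
  · intro A hA
    simp only [mem_filter, mem_powersetCard, subset_univ, true_and] at hA ⊢
    refine ⟨fun i hi => ?_, ?_⟩
    · simpa using (mem_sdiff.mp hi).2
    · rw [card_sdiff_of_subset hA.2, hA.1]
  · intro B hB
    simp only [mem_filter, mem_powersetCard, subset_univ, true_and] at hB ⊢
    have hd : Disjoint B T := disjoint_left.mpr fun i hi => by simpa using hB.1 hi
    refine ⟨?_, subset_union_right⟩
    rw [card_union_of_disjoint hd, hB.2]; omega
  · intro A hA
    simp only [mem_filter] at hA
    exact sdiff_union_of_subset hA.2
  · intro B hB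
    simp only [mem_powersetCard] at hB
    have hd : Disjoint B T := disjoint_left.mpr fun i hi => by simpa using hB.1 hi
    exact union_sdiff_cancel_right hd

/-- The overlap of a fixed set `S` with a random `k`-element set has a generating function
dominated, for arguments at least `1`, by that of the binomial law with `|S|` trials and success
probability `k / n`. -/
lemma subsetAvg_pow_card_inter_le {k : ℕ} (hk : k ≤ Fintype.card ι) (S : Finset ι) {u : ℝ}
    (hu : 0 ≤ u) :
    subsetAvg ι k (fun A => (1 + u) ^ #(A ∩ S)) ≤ (1 + u * (k / Fintype.card ι)) ^ #S := by
  have hc : (0 : ℝ) < (Fintype.card ι).choose k := by exact_mod_cast Nat.choose_pos hk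
  rw [subsetAvg, inv_mul_le_iff₀ hc]
  have h1 : ∀ A : Finset ι, (1 + u) ^ #(A ∩ S) =
      ∑ T ∈ S.powerset, if T ⊆ A then u ^ #T else 0 := fun A => by
    rw [← sum_filter]
    have : {T ∈ S.powerset | T ⊆ A} = (A ∩ S).powerset := by
      ext T; simp only [mem_filter, mem_powerset, subset_inter_iff, and_comm]
    rw [this, add_comm, ← prod_const, prod_add]
    simp
  simp_rw [h1]
  rw [sum_comm]
  have h2 : (1 + u * (k / Fintype.card ι : ℝ)) ^ #S =
      ∑ T ∈ S.powerset, (u * (k / Fintype.card ι : ℝ)) ^ #T := by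
    rw [add_comm, ← prod_const, prod_add]
    simp
  rw [h2, mul_sum]
  refine sum_le_sum fun T _ => ?_
  rw [← sum_filter, sum_const, nsmul_eq_mul]
  by_cases hT : #T ≤ k
  · rw [card_powersetCard_filter_superset hT, mul_pow, mul_left_comm, mul_comm _ (u ^ #T)]
    exact mul_le_mul_of_nonneg_left (choose_sub_le _ _ _ hk hT) (by positivity)
  · have : {A ∈ powersetCard k (univ : Finset ι) | T ⊆ A} = ∅ := by
      refine filter_eq_empty_iff.mpr fun A hA hTA => hT ?_
      rw [← (mem_powersetCard.mp hA).2]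
      exact card_le_card hTA
    rw [this]
    simp only [card_empty, Nat.cast_zero, zero_mul]
    positivity

lemma subsetAvg_compl {k : ℕ} (hk : k ≤ Fintype.card ι) (f : Finset ι → ℝ) :
    subsetAvg ι k (fun A => f Aᶜ) = subsetAvg ι (Fintype.card ι - k) f := by
  unfold subsetAvg
  rw [Nat.choose_symm hk]
  congr 1
  refine sum_bij' (fun A _ => Aᶜ) (fun A _ => Aᶜ) ?_ ?_ ?_ ?_ ?_
  · intro A hA
    simp only [mem_powersetCard, subset_univ, true_and] at hA ⊢
    rw [card_compl, hA]
  · intro A hA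
    simp only [mem_powersetCard, subset_univ, true_and] at hA ⊢
    rw [card_compl, hA]; omega
  all_goals simp

lemma exp_sub_one_sub_le {x : ℝ} (hx : |x| ≤ 1) : Real.exp x - 1 - x ≤ x ^ 2 :=
  (le_abs_self _).trans (Real.abs_exp_sub_one_sub_id_le hx)

/-- The overlap of two `k`-element sets, one of them random, is concentrated around `k² / n`. -/
lemma subsetAvg_exp_abs_overlap_le {k : ℕ} (hk : k ≤ Fintype.card ι) (S : Finset ι) (hS : #S = k)
    {ε l : ℝ} (hε : (k : ℝ) = ε * Fintype.card ι) (hε0 : 0 < ε)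
    (hl : 0 ≤ l) (hl1 : l ≤ 1) :
    subsetAvg ι k (fun A => Real.exp (l * |(#(A ∩ S) : ℝ) - ε * k|)) ≤
      2 * Real.exp (ε * k * l ^ 2) := by
  obtain hn | hn := Nat.eq_zero_or_pos (Fintype.card ι)
  · have hk0 : k = 0 := by omega
    subst hk0
    have : S = ∅ := card_eq_zero.mp hS
    subst this
    simp only [inter_empty, card_empty, Nat.cast_zero, mul_zero, sub_zero, abs_zero, zero_mul,
      Real.exp_zero]
    rw [subsetAvg_const hk]
    norm_num
  have hn' : (0 : ℝ) < Fintype.card ι := by exact_mod_cast hn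
  have hεdiv : (k : ℝ) / Fintype.card ι = ε := by rw [hε]; field_simp
  have hε1 : ε ≤ 1 := by
    rw [← hεdiv, div_le_one hn']; exact_mod_cast hk
  have hexp : 0 ≤ Real.exp l - 1 := by linarith [Real.add_one_le_exp l]
  have hup : subsetAvg ι k (fun A => Real.exp (l * ((#(A ∩ S) : ℝ) - ε * k))) ≤
      Real.exp (ε * k * l ^ 2) := by
    have h1 : ∀ A : Finset ι, Real.exp (l * ((#(A ∩ S) : ℝ) - ε * k)) =
        Real.exp (-(l * (ε * k))) * (1 + (Real.exp l - 1)) ^ #(A ∩ S) := fun A => by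
      rw [add_sub_cancel, ← Real.exp_nat_mul, ← Real.exp_add]; congr 1; ring
    simp_rw [h1]
    rw [subsetAvg_const_mul]
    have h2 := subsetAvg_pow_card_inter_le hk S hexp
    rw [hεdiv, hS] at h2
    calc _ ≤ Real.exp (-(l * (ε * k))) * (Real.exp ((Real.exp l - 1) * ε)) ^ k := by
          refine mul_le_mul_of_nonneg_left (h2.trans ?_) (Real.exp_nonneg _)
          gcongr
          rw [add_comm]; exact Real.add_one_le_exp _
      _ = Real.exp (ε * k * (Real.exp l - 1 - l)) := by
          rw [← Real.exp_nat_mul, ← Real.exp_add]; congr 1; ring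
      _ ≤ _ := by
          gcongr
          exact exp_sub_one_sub_le (by rwa [abs_of_nonneg hl])
  have hlow : subsetAvg ι k (fun A => Real.exp (-(l * ((#(A ∩ S) : ℝ) - ε * k)))) ≤
      Real.exp (ε * k * l ^ 2) := by
    -- the lower tail is the upper tail of the overlap with the complement of the random set
    have h1 : ∀ A : Finset ι, Real.exp (-(l * ((#(A ∩ S) : ℝ) - ε * k))) =
        Real.exp (-(l * (k - ε * k))) * (1 + (Real.exp l - 1)) ^ #(Aᶜ ∩ S) := fun A => by
      have : k = #(A ∩ S) + #(Aᶜ ∩ S) := by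
        rw [← hS, inter_comm A S, inter_comm Aᶜ S, ← sdiff_eq_inter_compl,
          card_inter_add_card_sdiff]
      have : (k : ℝ) = #(A ∩ S) + #(Aᶜ ∩ S) := by exact_mod_cast this
      rw [add_sub_cancel, ← Real.exp_nat_mul, ← Real.exp_add]
      congr 1
      linear_combination l * this
    simp_rw [h1]
    rw [subsetAvg_const_mul, subsetAvg_compl hk fun A => (1 + (Real.exp l - 1)) ^ #(A ∩ S)]
    have h2 := subsetAvg_pow_card_inter_le (Nat.sub_le (Fintype.card ι) k) S hexp
    have h3 : ((Fintype.card ι - k : ℕ) : ℝ) / Fintype.card ι = 1 - ε := by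
      rw [Nat.cast_sub hk, ← hεdiv]; field_simp
    rw [h3, hS] at h2
    have h4 : 1 + (Real.exp l - 1) * (1 - ε) ≤ Real.exp (l + ε * (Real.exp (-l) - 1)) := by
      have : 1 + (Real.exp l - 1) * (1 - ε) = Real.exp l * (ε * (Real.exp (-l) - 1) + 1) := by
        have : Real.exp l * Real.exp (-l) = 1 := by rw [← Real.exp_add]; simp
        linear_combination (-ε) * this
      rw [this, Real.exp_add]
      gcongr
      exact Real.add_one_le_exp _
    have h5 : 0 ≤ 1 + (Real.exp l - 1) * (1 - ε) := by
      have : 0 ≤ (Real.exp l - 1) * (1 - ε) := mul_nonneg hexp (by linarith)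
      linarith
    calc _ ≤ Real.exp (-(l * (k - ε * k))) * (Real.exp (l + ε * (Real.exp (-l) - 1))) ^ k := by
          refine mul_le_mul_of_nonneg_left (h2.trans ?_) (Real.exp_nonneg _)
          gcongr
      _ = Real.exp (ε * k * (Real.exp (-l) - 1 - (-l))) := by
          rw [← Real.exp_nat_mul, ← Real.exp_add]; congr 1; ring
      _ ≤ _ := by
          gcongr
          rw [← neg_sq l]
          exact exp_sub_one_sub_le (by rwa [abs_neg, abs_of_nonneg hl])
  calc _ ≤ subsetAvg ι k (fun A => Real.exp (l * ((#(A ∩ S) : ℝ) - ε * k)) +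
        Real.exp (-(l * ((#(A ∩ S) : ℝ) - ε * k)))) := by
        refine subsetAvg_mono fun A _ => ?_
        have := Real.exp_pos (l * ((#(A ∩ S) : ℝ) - ε * k))
        have := Real.exp_pos (-(l * ((#(A ∩ S) : ℝ) - ε * k)))
        rcases abs_cases ((#(A ∩ S) : ℝ) - ε * k) with ⟨h, _⟩ | ⟨h, _⟩ <;> rw [h]
        · linarith
        · rw [mul_neg]; linarith
    _ ≤ _ := by rw [subsetAvg_add]; linarith

end Overlap

/-! ### The parameter regime -/

lemma inv_sqrt_pow_le_exp {D T : ℝ} (hT0 : 0 ≤ T) (hT : T ≤ 1 / 2) (hD : 1 - T ≤ D) (d : ℕ) :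
    (√D)⁻¹ ^ d ≤ Real.exp (d * T) := by
  have hexp : Real.exp (-(2 * T)) ≤ D := by
    have h1 : Real.exp (-(2 * T)) * 1 ≤ Real.exp (-(2 * T)) * (Real.exp (2 * T) * (1 - T)) := by
      gcongr
      have : (2 * T + 1) * (1 - T) ≤ Real.exp (2 * T) * (1 - T) := by
        gcongr
        · linarith
        · exact Real.add_one_le_exp _
      nlinarith
    rw [mul_one, ← mul_assoc, ← Real.exp_add, neg_add_cancel, Real.exp_zero, one_mul] at h1
    linarith
  have hsqrt : Real.exp (-T) ≤ √D := by
    refine Real.le_sqrt_of_sq_le ?_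
    rw [← Real.exp_nat_mul]
    convert! hexp using 2
    push_cast; ring
  calc _ ≤ (Real.exp (-T))⁻¹ ^ d := by gcongr
    _ = Real.exp (d * T) := by rw [← Real.exp_neg, neg_neg, Real.exp_nat_mul]

/-- The inequalities between the parameters under which the planted dataset is statistically close
to the null one; the fractional powers of the sample size bound are cleared, and `α ≤ 1` is not
required. The constants are small enough for the bound `1 + 1 / 100` on the second moment of the
likelihood ratio. -/
structure HardRegime (n d k : ℕ) (ε α : ℝ) : Prop where
  d_pos : 0 < d
  ε_pos : 0 < ε
  ε_le_one : ε ≤ 1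
  α_pos : 0 < α
  card_eq : (k : ℝ) = ε * n
  sqrt_le : √(d : ℝ) ≤ α ^ 2 * n
  cube_le : (d : ℝ) * ε ^ 3 ≤ α ^ 4 * n
  n_pow_le : (n : ℝ) ^ 3 * α ^ 8 ≤ (1 / 20000 * (d * ε)) ^ 2
  n_le : (n : ℝ) * α ^ 2 ≤ 1 / 1000 * (d * ε)

namespace HardRegime

variable {n d k : ℕ} {ε α : ℝ} (h : HardRegime n d k ε α)
include h

lemma d_pos' : (0 : ℝ) < d := by exact_mod_cast h.d_pos

lemma n_pos : (0 : ℝ) < n := by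
  have h1 := h.sqrt_le
  have h2 : 0 < √(d : ℝ) := Real.sqrt_pos.mpr h.d_pos'
  have := h.α_pos
  by_contra hn
  have : α ^ 2 * n ≤ 0 := mul_nonpos_of_nonneg_of_nonpos (by positivity) (not_lt.mp hn)
  linarith

lemma k_le : k ≤ n := by
  have : (k : ℝ) ≤ n := by
    rw [h.card_eq]; exact mul_le_of_le_one_left h.n_pos.le h.ε_le_one
  exact_mod_cast this

/-- The quadratic equation and the bounds satisfied by the correlation parameter. -/
lemma correlation_spec {β : ℝ} (hβ : β = correlation n d ε α) :
    0 ≤ β ∧ n * β ^ 2 + α ^ 2 / (d * ε) = 2 * β ∧ α ^ 2 / (d * ε) ≤ 2 * β ∧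
      2 * β ≤ 1.01 * (α ^ 2 / (d * ε)) ∧ β * n ≤ 1 / 1000 := by
  have hn := h.n_pos
  have hd := h.d_pos'
  have hε := h.ε_pos
  have hα := h.α_pos
  have hdε : 0 < d * ε := by positivity
  set y := α ^ 2 / (d * ε) with hy
  have hy0 : 0 < y := by positivity
  have hx : y * n ≤ 1 / 1000 := by
    rw [hy, div_mul_eq_mul_div, div_le_iff₀ hdε, mul_comm (α ^ 2)]; exact h.n_le
  set s := √(1 - y * n) with hs
  have hs0 : 0 ≤ s := Real.sqrt_nonneg _
  have hs2 : s ^ 2 = 1 - y * n := Real.sq_sqrt (by linarith)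
  have hβs : β * n = 1 - s := by
    rw [hβ, correlation, show α ^ 2 * (n : ℝ) / (d * ε) = y * n by rw [hy]; ring, ← hs]
    field_simp
  have hyn : 0 < y * n := by positivity
  have hs1 : s ≤ 1 := by nlinarith
  have h1s : 1 - s ≤ y * n := by nlinarith
  have hlow : y * n ≤ 2 * (1 - s) := by nlinarith
  have hhigh : 2 * (1 - s) ≤ 1.01 * (y * n) := by nlinarith
  have hq : n * β ^ 2 + y = 2 * β := by
    have : n * (n * β ^ 2 + y) = n * (2 * β) := by
      linear_combination (β * n - 1 - s) * hβs + hs2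
    exact mul_left_cancel₀ hn.ne' this
  refine ⟨?_, hq, ?_, ?_, by linarith⟩
  · exact nonneg_of_mul_nonneg_left (by linarith : 0 ≤ β * n) hn
  · refine le_of_mul_le_mul_right ?_ hn
    linarith
  · refine le_of_mul_le_mul_right ?_ hn
    linarith

/-- The sample size is large compared with `ε⁻²` and small compared with `ε⁻⁴`, and `d β² n` is
small compared with `1 / (ε √n)`. -/
lemma scales {β : ℝ} (hβ : β = correlation n d ε α) :
    20000 ≤ ε * √n ∧ √n * ε ^ 2 ≤ 1 / 20000 ∧ d * β ^ 2 * n * (ε * √n) ≤ 1 / 20000 := by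
  have hn := h.n_pos
  have hd := h.d_pos'
  have hε := h.ε_pos
  have hα := h.α_pos
  set r := √(n : ℝ) with hr
  have hr0 : 0 < r := Real.sqrt_pos.mpr hn
  have hr2 : r ^ 2 = n := Real.sq_sqrt hn.le
  have h3 : r ^ 3 * α ^ 4 ≤ 1 / 20000 * (d * ε) := by
    refine le_of_sq_le_sq ?_ (by positivity)
    calc (r ^ 3 * α ^ 4) ^ 2 = (r ^ 2) ^ 3 * α ^ 8 := by ring
      _ ≤ _ := by rw [hr2]; exact h.n_pow_le
  have h1 : (d : ℝ) ≤ α ^ 4 * r ^ 4 := by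
    calc (d : ℝ) = √(d : ℝ) ^ 2 := (Real.sq_sqrt hd.le).symm
      _ ≤ (α ^ 2 * n) ^ 2 := by gcongr; exact h.sqrt_le
      _ = _ := by rw [← hr2]; ring
  have h2 : (d : ℝ) * ε ^ 3 ≤ α ^ 4 * r ^ 2 := by rw [hr2]; exact h.cube_le
  refine ⟨?_, ?_, ?_⟩
  · have : (r ^ 3 * α ^ 4) * 20000 ≤ (r ^ 3 * α ^ 4) * (ε * r) := by nlinarith
    exact le_of_mul_le_mul_left this (by positivity)
  · have : (r ^ 2 * α ^ 4) * (r * ε ^ 2) ≤ (r ^ 2 * α ^ 4) * (1 / 20000) := by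
      have := mul_le_mul_of_nonneg_right h3 (sq_nonneg ε)
      nlinarith
    exact le_of_mul_le_mul_left this (by positivity)
  · obtain ⟨hβ0, -, -, hβ1, -⟩ := h.correlation_spec hβ
    have hβ2 : β ≤ α ^ 2 / (d * ε) := by
      have : 0 < α ^ 2 / (d * ε) := by positivity
      linarith
    calc d * β ^ 2 * n * (ε * r) ≤ d * (α ^ 2 / (d * ε)) ^ 2 * n * (ε * r) := by gcongr
      _ = (r ^ 3 * α ^ 4) / (d * ε) := by rw [← hr2]; field_simp
      _ ≤ _ := by rw [div_le_iff₀ (by positivity)]; exact h3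

lemma covariance_small {β : ℝ} (hβ : β = correlation n d ε α) :
    (2 * β + 2 * β * ε) * Fintype.card (Fin n) ≤ 1 / 2 := by
  obtain ⟨hβ0, -, -, -, hβn⟩ := h.correlation_spec hβ
  have hn := h.n_pos
  rw [Fintype.card_fin]
  have : 0 ≤ β * n := by positivity
  nlinarith [h.ε_le_one]

/-- The choice of `β` makes the variance of the mean of the uncorrupted points equal to `2 β ε`
in each coordinate. -/
lemma variance_eq {β : ℝ} (hβ : β = correlation n d ε α) {A : Finset (Fin n)} (hA : A.card = k) :
    2 * β * ε = β ^ 2 * A.card + √(α ^ 2 / d) ^ 2 := by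
  obtain ⟨-, hq, -⟩ := h.correlation_spec hβ
  have hd := h.d_pos'
  have hε := h.ε_pos
  rw [Real.sq_sqrt (by positivity), hA, h.card_eq, ← hq]
  field_simp

/-- The correlation of two planted likelihoods in `d` coordinates is at most the exponential of the
deviation of the overlap of the two index sets from its mean, up to small constants. -/
lemma inv_sqrt_det_pow_le {β : ℝ} (hβ : β = correlation n d ε α) {A A' : Finset (Fin n)}
    (hA : A.card = k) (hA' : A'.card = k) :
    (√(1 - covDeviation β (2 * β * ε) A * covDeviation β (2 * β * ε) A').det)⁻¹ ^ d ≤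
      Real.exp (4 * (1 / 20000) ^ 2 +
        18 * (d * β ^ 2 * n) * |((A ∩ A').card : ℝ) - ε * k|) := by
  obtain ⟨hβ0, -, -, -, hβn⟩ := h.correlation_spec hβ
  obtain ⟨-, hs1, hs2⟩ := h.scales hβ
  have hn := h.n_pos
  have hε := h.ε_pos
  have hε1 := h.ε_le_one
  have hk := h.card_eq
  have hj0 : (0 : ℝ) ≤ (A ∩ A').card := Nat.cast_nonneg _
  have hjk : ((A ∩ A').card : ℝ) ≤ k := by
    exact_mod_cast (Finset.card_le_card Finset.inter_subset_left).trans hA.le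
  set t := ((A ∩ A').card : ℝ) - ε * k with ht
  have hkn : (k : ℝ) ≤ n := by exact_mod_cast h.k_le
  have hεk : ε * k ≤ k := mul_le_of_le_one_left (Nat.cast_nonneg _) hε1
  have hεk0 : 0 ≤ ε * k := by positivity
  have htn : |t| ≤ n := abs_le.mpr ⟨by linarith, by linarith⟩
  rw [det_one_sub_covDeviation_mul β (2 * β * ε) A A' hA hA' rfl rfl rfl, Fintype.card_fin]
  have hj : ((A ∩ A').card : ℝ) = t + ε * k := by rw [ht]; ring
  set τ : ℝ := β ^ 2 * (4 * n ^ 2 * (1 - ε) ^ 2 * ε ^ 4 + 2 * n * (1 - 2 * ε ^ 2) ^ 2 * t +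
    4 * (1 + ε) ^ 2 * t ^ 2) with hτ
  have hdet : ∀ a : ℝ, a = t + ε * k → 1 - (2 * β ^ 2 * (a * (n - 2 * k + a) + (k - a) ^ 2) -
      4 * β * (2 * β * ε) * (k - a) * (n - 2 * k + a) + (2 * β * ε) ^ 2 * (n - 2 * k + a) ^ 2) =
      1 - τ := fun a ha => by
    rw [ha, hτ, hk]; ring
  rw [hdet _ hj]
  set q : ℝ := (β ^ 2 * ((A ∩ A').card * (n - 2 * k + (A ∩ A').card) - (k - (A ∩ A').card) ^ 2)) ^ 2
  have hq : 0 ≤ q := sq_nonneg _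
  set T : ℝ := β ^ 2 * (4 * n ^ 2 * ε ^ 4 + 18 * n * |t|) with hT
  have hτT : τ ≤ T := by
    have e1 : (1 - ε) ^ 2 ≤ 1 := by nlinarith
    have e2 : (1 - 2 * ε ^ 2) ^ 2 ≤ 1 := by nlinarith [pow_le_one₀ (n := 2) hε.le hε1, sq_nonneg ε]
    have e3 : (1 + ε) ^ 2 ≤ 4 := by nlinarith
    have e4 : t ^ 2 ≤ n * |t| := by
      rw [← sq_abs, sq]; exact mul_le_mul_of_nonneg_right htn (abs_nonneg _)
    have e5 : 4 * (n : ℝ) ^ 2 * (1 - ε) ^ 2 * ε ^ 4 ≤ 4 * n ^ 2 * 1 * ε ^ 4 := by gcongr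
    have e6 : 2 * (n : ℝ) * (1 - 2 * ε ^ 2) ^ 2 * t ≤ 2 * n * 1 * |t| := by
      calc _ ≤ 2 * (n : ℝ) * (1 - 2 * ε ^ 2) ^ 2 * |t| := by gcongr; exact le_abs_self t
        _ ≤ _ := by gcongr
    have e7 : 4 * (1 + ε) ^ 2 * t ^ 2 ≤ 4 * 4 * (n * |t|) := by gcongr
    rw [hτ, hT]
    exact mul_le_mul_of_nonneg_left (by linarith) (sq_nonneg _)
  have hT0 : 0 ≤ T := by positivity
  have hThalf : T ≤ 1 / 2 := by
    calc T ≤ β ^ 2 * (4 * n ^ 2 * 1 + 18 * n * n) := by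
          rw [hT]; gcongr; exact pow_le_one₀ hε.le hε1
      _ = 22 * (β * n) ^ 2 := by ring
      _ ≤ 22 * (1 / 1000) ^ 2 := by gcongr
      _ ≤ _ := by norm_num
  refine (inv_sqrt_pow_le_exp hT0 hThalf (by linarith : 1 - T ≤ 1 - τ + q) d).trans ?_
  refine Real.exp_le_exp.mpr ?_
  have h1 : d * β ^ 2 * n * (ε * √n) * (√n * ε ^ 2) * ε ≤
      1 / 20000 * (1 / 20000) * 1 := by gcongr
  have h2 : d * β ^ 2 * n * (ε * √n) * (√n * ε ^ 2) * ε = d * β ^ 2 * n ^ 2 * ε ^ 4 := by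
    have := Real.sq_sqrt hn.le
    linear_combination (d * β ^ 2 * n * ε ^ 4) * this
  have h3 : d * T = 4 * (d * β ^ 2 * n ^ 2 * ε ^ 4) + 18 * (d * β ^ 2 * n) * |t| := by
    rw [hT]; ring
  linarith

/-- The second moment of the planted likelihood ratio, averaged over one of the index sets. -/
lemma subsetAvg_inv_sqrt_det_pow_le {β : ℝ} (hβ : β = correlation n d ε α) {A' : Finset (Fin n)}
    (hA' : A'.card = k) :
    subsetAvg (Fin n) k (fun A =>
      (√(1 - covDeviation β (2 * β * ε) A * covDeviation β (2 * β * ε) A').det)⁻¹ ^ d) ≤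
      1 + 1 / 100 := by
  obtain ⟨hs0, -, hs2⟩ := h.scales hβ
  have hn := h.n_pos
  have hε := h.ε_pos
  set m := d * β ^ 2 * n with hm
  have hm0 : 0 ≤ m := by positivity
  have hm1 : m ≤ (1 / 20000) ^ 2 := by nlinarith
  have hkc : k ≤ Fintype.card (Fin n) := by rw [Fintype.card_fin]; exact h.k_le
  -- convexity: `exp y ≤ 1 + (exp (200 y) - 1) / 200`
  have hconv : ∀ y : ℝ, Real.exp y ≤ 1 / 200 * Real.exp (200 * y) + 199 / 200 := fun y => by
    have := convexOn_exp.2 (Set.mem_univ (200 * y)) (Set.mem_univ (0 : ℝ))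
      (by norm_num : (0 : ℝ) ≤ 1 / 200) (by norm_num : (0 : ℝ) ≤ 199 / 200) (by norm_num)
    simp only [smul_eq_mul, mul_zero, add_zero, Real.exp_zero, mul_one] at this
    calc Real.exp y = Real.exp (1 / 200 * (200 * y)) := by congr 1; ring
      _ ≤ _ := this
  -- `3600 = 200 * 18` is the coefficient of the overlap after the exponent is scaled by `200`
  have hov := subsetAvg_exp_abs_overlap_le (ε := ε) (l := 3600 * m) hkc A' hA'
    (by rw [Fintype.card_fin]; exact h.card_eq) hε (by positivity) (by linarith)
  have he : Real.exp (ε * k * (3600 * m) ^ 2) ≤ 1.04 := by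
    have h1 : ε * k * (3600 * m) ^ 2 = 3600 ^ 2 * (m * (ε * √n)) ^ 2 := by
      rw [h.card_eq]
      have := Real.sq_sqrt hn.le
      linear_combination (-(ε ^ 2 * 3600 ^ 2 * m ^ 2)) * this
    have h2 : 0 ≤ m * (ε * √n) := by positivity
    have h3 : ε * k * (3600 * m) ^ 2 ≤ 0.0324 := by
      rw [h1]
      calc _ ≤ 3600 ^ 2 * (1 / 20000 : ℝ) ^ 2 := by gcongr
        _ = _ := by norm_num
    have h4 := Real.abs_exp_sub_one_sub_id_le
      (abs_le.mpr ⟨by linarith [show 0 ≤ ε * k * (3600 * m) ^ 2 by positivity],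
        by linarith⟩ : |ε * k * (3600 * m) ^ 2| ≤ 1)
    have h5 := (abs_le.mp h4).2
    nlinarith [show 0 ≤ ε * k * (3600 * m) ^ 2 by positivity]
  have he2 : Real.exp (200 * (4 * (1 / 20000) ^ 2)) ≤ 1.01 := by
    have h4 := Real.abs_exp_sub_one_sub_id_le
      (by norm_num [abs_le] : |200 * (4 * (1 / 20000 : ℝ) ^ 2)| ≤ 1)
    have h5 := (abs_le.mp h4).2
    norm_num at h5 ⊢
    linarith
  calc _ ≤ subsetAvg (Fin n) k (fun A => 1 / 200 * Real.exp (200 * (4 * (1 / 20000) ^ 2)) *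
        Real.exp (3600 * m * |((A ∩ A').card : ℝ) - ε * k|) + 199 / 200) := by
        refine subsetAvg_mono fun A hA => ?_
        refine (h.inv_sqrt_det_pow_le hβ hA hA').trans ((hconv _).trans ?_)
        rw [mul_assoc (1 / 200 : ℝ), ← Real.exp_add]
        refine le_of_eq ?_
        congr 3
        ring
    _ = 1 / 200 * Real.exp (200 * (4 * (1 / 20000) ^ 2)) * subsetAvg (Fin n) k (fun A =>
        Real.exp (3600 * m * |((A ∩ A').card : ℝ) - ε * k|)) + 199 / 200 := by
        rw [subsetAvg_add, subsetAvg_const_mul, subsetAvg_const hkc]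
    _ ≤ 1 / 200 * 1.01 * (2 * 1.04) + 199 / 200 := by
        gcongr
        · unfold subsetAvg; positivity
        · exact hov.trans (by gcongr)
    _ ≤ _ := by norm_num

end HardRegime

/-! ### The dataset as independent coordinates -/

section Transpose

/-- The dataset whose `r`-th coordinates form the vector `y r`. -/
def ofRows {n d : ℕ} (y : Fin d → Fin n → ℝ) : Sample n d :=
  fun i => WithLp.toLp 2 fun r => y r i

lemma measurable_ofRows {n d : ℕ} : Measurable (ofRows (n := n) (d := d)) := by
  unfold ofRows
  refine measurable_pi_lambda _ fun i => ?_
  exact (WithLp.measurable_toLp 2 _).comp (by fun_prop)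

/-- The law of `d` independent coordinates of `n` independent standard Gaussians. -/
def gaussianRows (n d : ℕ) : Measure (Fin d → Fin n → ℝ) :=
  Measure.pi fun _ => stdGaussianPi (Fin n)

instance (n d : ℕ) : IsProbabilityMeasure (gaussianRows n d) := by
  unfold gaussianRows; infer_instance

lemma pi_map_curry {ι κ E : Type*} [Fintype ι] [Fintype κ] [MeasurableSpace E] (μ : Measure E)
    [IsProbabilityMeasure μ] :
    (Measure.pi fun _ : ι × κ => μ).map (MeasurableEquiv.curry ι κ E) =
      Measure.pi fun _ : ι => Measure.pi fun _ : κ => μ := by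
  simpa only [Measure.infinitePi_eq_pi] using
    Measure.infinitePi_map_curry (X := E) (fun (_ : ι) (_ : κ) => μ)

lemma map_swap_pi {ι κ E : Type*} [Fintype ι] [Fintype κ] [MeasurableSpace E] (μ : Measure E)
    [IsProbabilityMeasure μ] :
    (Measure.pi fun _ : ι => Measure.pi fun _ : κ => μ).map (fun y j i => y i j) =
      Measure.pi fun _ : κ => Measure.pi fun _ : ι => μ := by
  have hs := Measure.pi_map_piCongrLeft (Equiv.prodComm ι κ) (β := fun _ => E) (fun _ => μ)
  have hm : Measurable (fun (y : ι → κ → E) j i => y i j) := by fun_prop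
  rw [← pi_map_curry μ, ← pi_map_curry μ, ← hs, Measure.map_map hm (MeasurableEquiv.measurable _),
    Measure.map_map (MeasurableEquiv.measurable _) (MeasurableEquiv.measurable _)]
  rfl

lemma nullLaw_eq_map (n d : ℕ) : nullLaw n d = (gaussianRows n d).map ofRows := by
  have h1 : (fun y : Fin n → Fin d → ℝ => fun i => WithLp.toLp 2 (y i)) ∘
      (fun (y : Fin d → Fin n → ℝ) i r => y r i) = ofRows := rfl
  rw [nullLaw, iidGaussian, ← h1, ← Measure.map_map, gaussianRows]
  · unfold stdGaussianPi
    rw [map_swap_pi, Measure.pi_map_pi (fun _ => (WithLp.measurable_toLp 2 _).aemeasurable)]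
    simp_rw [multivariateGaussian_zero_one, map_pi_eq_stdGaussian]
  · exact measurable_pi_lambda _ fun i => (WithLp.measurable_toLp 2 _).comp (by fun_prop)
  · fun_prop

instance (n d : ℕ) : IsProbabilityMeasure (nullLaw n d) := by
  rw [nullLaw_eq_map]
  exact Measure.isProbabilityMeasure_map measurable_ofRows.aemeasurable

lemma multivariateGaussian_smul_one {d : ℕ} {v : ℝ} (hv : 0 ≤ v) :
    multivariateGaussian (0 : EuclideanSpace ℝ (Fin d)) (v • (1 : Matrix (Fin d) (Fin d) ℝ)) =
      (stdGaussianPi (Fin d)).map fun x => WithLp.toLp 2 fun r => √v * x r := by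
  have h1 : (v • (1 : Matrix (Fin d) (Fin d) ℝ)).PosSemidef := PosSemidef.one.smul hv
  have h2 : (fun x : Fin d → ℝ => WithLp.toLp 2 fun r => √v * x r) =
      (fun x : EuclideanSpace ℝ (Fin d) => √v • x) ∘ WithLp.toLp 2 := rfl
  rw [h2, ← Measure.map_map (by fun_prop) (WithLp.measurable_toLp 2 _), stdGaussianPi,
    map_pi_eq_stdGaussian]
  have : IsProbabilityMeasure ((stdGaussian (EuclideanSpace ℝ (Fin d))).map fun x => √v • x) :=
    Measure.isProbabilityMeasure_map (by fun_prop)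
  apply Measure.ext_of_charFun
  ext t
  rw [charFun_multivariateGaussian h1, charFun_map_smul, charFun_stdGaussian, norm_smul,
    ← Complex.ofReal_pow, mul_pow,
    Real.norm_eq_abs, sq_abs, Real.sq_sqrt hv, inner_zero_right, smul_mulVec, one_mulVec,
    dotProduct_smul, EuclideanSpace.real_norm_sq_eq]
  congr 1
  simp [dotProduct, sq]
  ring

/-- The noise of the planted dataset, with one standard Gaussian pair (noise vector, normalised
shift) for each coordinate. -/
def pairRows (n d : ℕ) : Measure (Fin d → (Fin n → ℝ) × ℝ) :=
  Measure.pi fun _ => (stdGaussianPi (Fin n)).prod (gaussianReal 0 1)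

instance (n d : ℕ) : IsProbabilityMeasure (pairRows n d) := by
  unfold pairRows; infer_instance

/-- The noise and the shift read off from their coordinates; `w` is the standard deviation of the
coordinates of the shift. -/
def ofPairRows {n d : ℕ} (w : ℝ) (q : Fin d → (Fin n → ℝ) × ℝ) :
    Sample n d × EuclideanSpace ℝ (Fin d) :=
  (ofRows fun r => (q r).1, WithLp.toLp 2 fun r => w * (q r).2)

lemma measurable_ofPairRows {n d : ℕ} (w : ℝ) : Measurable (ofPairRows (n := n) (d := d) w) := by
  refine Measurable.prodMk (measurable_ofRows.comp (by fun_prop)) ?_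
  exact (WithLp.measurable_toLp 2 _).comp (by fun_prop)

lemma nullLaw_prod_eq_map (n d : ℕ) {v : ℝ} (hv : 0 ≤ v) :
    (nullLaw n d).prod (multivariateGaussian (0 : EuclideanSpace ℝ (Fin d))
      (v • (1 : Matrix (Fin d) (Fin d) ℝ))) = (pairRows n d).map (ofPairRows √v) := by
  have hm : Measurable fun x : Fin d → ℝ =>
      (WithLp.toLp 2 fun r => √v * x r : EuclideanSpace ℝ (Fin d)) :=
    (WithLp.measurable_toLp 2 _).comp (by fun_prop)
  have h := measurePreserving_arrowProdEquivProdArrow (Fin n → ℝ) ℝ (Fin d)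
    (fun _ => stdGaussianPi (Fin n)) (fun _ => gaussianReal 0 1)
  rw [nullLaw_eq_map, multivariateGaussian_smul_one hv,
    Measure.map_prod_map _ _ measurable_ofRows hm]
  unfold gaussianRows pairRows
  rw [stdGaussianPi, stdGaussianPi] at *
  rw [← h.map_eq, Measure.map_map (measurable_ofRows.prodMap hm) h.measurable]
  rfl

lemma measurable_plant {n d : ℕ} (β : ℝ) (A : Finset (Fin n)) :
    Measurable fun p : Sample n d × EuclideanSpace ℝ (Fin d) => plant β A p.1 p.2 := by
  refine measurable_pi_lambda _ fun i => ?_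
  unfold plant
  split_ifs <;> fun_prop

instance (n d : ℕ) (α β : ℝ) (A : Finset (Fin n)) :
    IsProbabilityMeasure (altLawGiven n d α β A) :=
  Measure.isProbabilityMeasure_map (measurable_plant β A).aemeasurable

/-- The likelihood ratio of the planted dataset, given the corrupted index set. -/
def plantRatio {n : ℕ} (d : ℕ) (β γ : ℝ) (A : Finset (Fin n)) (y : Fin d → Fin n → ℝ) : ℝ :=
  ∏ r, gaussianRatio (plantCov β γ A) (y r)

lemma altLawGiven_eq_map_withDensity {n d : ℕ} {α β γ : ℝ} {A : Finset (Fin n)}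
    (hγ : γ = β ^ 2 * A.card + √(α ^ 2 / d) ^ 2) (hS : (plantCov β γ A).PosDef) :
    altLawGiven n d α β A =
      ((gaussianRows n d).withDensity
        fun y => ENNReal.ofReal (plantRatio d β γ A y)).map ofRows := by
  have h1 : (fun p : Sample n d × EuclideanSpace ℝ (Fin d) => plant β A p.1 p.2) ∘
      ofPairRows √(α ^ 2 / d) =
      ofRows ∘ fun q r => plantRow β √(α ^ 2 / d) A (q r) := by
    ext q i r
    by_cases hi : i ∈ A
    · simp [ofPairRows, ofRows, plant, plantRow, hi]
    · simp [ofPairRows, ofRows, plant, plantRow, hi]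
  have hm : Measurable fun (q : Fin d → (Fin n → ℝ) × ℝ) r => plantRow β √(α ^ 2 / d) A (q r) :=
    measurable_pi_lambda _ fun r => (measurable_plantRow _ _ A).comp (measurable_pi_apply r)
  rw [altLawGiven, nullLaw_prod_eq_map n d (by positivity),
    Measure.map_map (measurable_plant β A) (measurable_ofPairRows _), h1,
    ← Measure.map_map measurable_ofRows hm, pairRows,
    Measure.pi_map_pi fun _ => (measurable_plantRow _ _ A).aemeasurable]
  simp_rw [map_plantRow_eq_withDensity hγ hS]
  rw [pi_withDensity_ofReal _ (integrable_gaussianRatio hS).1 (gaussianRatio_nonneg _)]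
  rfl

end Transpose

/-! ### Indistinguishability -/

section Likelihood

variable {n d : ℕ} {β γ : ℝ}

lemma measurable_plantRatio (A : Finset (Fin n)) : Measurable (plantRatio d β γ A) := by
  unfold plantRatio
  exact Finset.measurable_prod _ fun r _ =>
    (measurable_gaussianRatio _).comp (measurable_pi_apply r)

lemma plantRatio_nonneg (A : Finset (Fin n)) (y : Fin d → Fin n → ℝ) :
    0 ≤ plantRatio d β γ A y :=
  Finset.prod_nonneg fun _ _ => gaussianRatio_nonneg _ _

lemma integral_plantRatio {A : Finset (Fin n)} (hS : (plantCov β γ A).PosDef) :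
    Integrable (plantRatio d β γ A) (gaussianRows n d) ∧
      ∫ y, plantRatio d β γ A y ∂(gaussianRows n d) = 1 := by
  obtain ⟨h1, h2⟩ := integrable_gaussianRatio hS
  refine ⟨Integrable.fintype_prod (f := fun _ => gaussianRatio (plantCov β γ A)) fun _ => h1, ?_⟩
  unfold plantRatio gaussianRows
  rw [integral_fintype_prod_eq_pow, h2, one_pow]

lemma integral_plantRatio_mul (hβ : 0 ≤ β) (hγ : 0 ≤ γ)
    (h : (2 * β + γ) * Fintype.card (Fin n) ≤ 1 / 2) (A A' : Finset (Fin n)) :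
    Integrable (fun y => plantRatio d β γ A y * plantRatio d β γ A' y) (gaussianRows n d) ∧
      ∫ y, plantRatio d β γ A y * plantRatio d β γ A' y ∂(gaussianRows n d) =
        (√(1 - covDeviation β γ A * covDeviation β γ A').det)⁻¹ ^ d := by
  obtain ⟨h1, h2⟩ := integral_gaussianRatio_mul (posDef_plantCov hβ hγ h A)
    (posDef_plantCov hβ hγ h A') (posDef_inv_add_inv_sub_one hβ hγ h A A')
  have he : ∀ S : Finset (Fin n), plantCov β γ S - 1 = covDeviation β γ S := fun S => by
    rw [plantCov, add_sub_cancel_left]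
  rw [he, he] at h2
  simp only [plantRatio, ← Finset.prod_mul_distrib]
  refine ⟨Integrable.fintype_prod (f := fun _ x => gaussianRatio (plantCov β γ A) x *
    gaussianRatio (plantCov β γ A') x) fun _ => h1, ?_⟩
  unfold gaussianRows
  rw [integral_fintype_prod_eq_pow fun x => gaussianRatio (plantCov β γ A) x *
    gaussianRatio (plantCov β γ A') x, h2, Fintype.card_fin]

/-- Averages over the index set commute with integrals. -/
lemma integral_subsetAvg {Y : Type*} [MeasurableSpace Y] {P : Measure Y} {k : ℕ}
    {f : Finset (Fin n) → Y → ℝ} (hf : ∀ A, A.card = k → Integrable (f A) P) :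
    Integrable (fun y => subsetAvg (Fin n) k fun A => f A y) P ∧
      ∫ y, subsetAvg (Fin n) k (fun A => f A y) ∂P =
        subsetAvg (Fin n) k fun A => ∫ y, f A y ∂P := by
  have hf' : ∀ A ∈ Finset.powersetCard k (Finset.univ : Finset (Fin n)), Integrable (f A) P :=
    fun A hA => hf A (Finset.mem_powersetCard.mp hA).2
  unfold subsetAvg
  refine ⟨(integrable_finsetSum _ hf').const_mul _, ?_⟩
  rw [integral_const_mul, integral_finsetSum _ hf']

lemma integral_altLaw {k : ℕ} {α : ℝ} {φ : Sample n d → ℝ} (hm : Measurable φ)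
    (h0 : ∀ x, 0 ≤ φ x) (h1 : ∀ x, φ x ≤ 1) :
    ∫ x, φ x ∂(altLaw n d k α β) =
      subsetAvg (Fin n) k fun A => ∫ x, φ x ∂(altLawGiven n d α β A) := by
  rw [altLaw, integral_smul_measure, integral_finsetSum_measure, subsetAvg]
  · simp
  · exact fun A _ => .of_bound hm.aestronglyMeasurable 1
      (ae_of_all _ fun x => by rw [Real.norm_eq_abs, abs_of_nonneg (h0 x)]; exact h1 x)

namespace HardRegime

variable {k : ℕ} {ε α : ℝ}

/-- No test with values in `[0, 1]` separates the null and the planted laws. -/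
lemma abs_integral_altLaw_sub_le (h : HardRegime n d k ε α) {φ : Sample n d → ℝ}
    (hm : Measurable φ) (h0 : ∀ x, 0 ≤ φ x) (h1 : ∀ x, φ x ≤ 1) :
    |∫ x, φ x ∂(nullLaw n d) - ∫ x, φ x ∂(altLaw n d k α (correlation n d ε α))| ≤ 1 / 10 := by
  set β := correlation n d ε α with hβ
  set γ := 2 * β * ε with hγ
  obtain ⟨hβ0, -⟩ := h.correlation_spec hβ
  have hγ0 : 0 ≤ γ := by have := h.ε_pos; positivity
  have hsm := h.covariance_small hβ
  have hkc : k ≤ Fintype.card (Fin n) := by rw [Fintype.card_fin]; exact h.k_le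
  set P := gaussianRows n d
  set L : Finset (Fin n) → (Fin d → Fin n → ℝ) → ℝ := plantRatio d β γ with hL
  have hS := posDef_plantCov hβ0 hγ0 hsm
  have hint : ∀ A, Integrable (L A) P := fun A => (integral_plantRatio (hS A)).1
  set ψ : (Fin d → Fin n → ℝ) → ℝ := fun y => φ (ofRows y) with hψ
  have hψm : Measurable ψ := hm.comp measurable_ofRows
  have hψb : ∀ᵐ y ∂P, ‖ψ y‖ ≤ 1 :=
    ae_of_all _ fun y => by rw [Real.norm_eq_abs, abs_of_nonneg (h0 _)]; exact h1 _
  have hnull : ∫ x, φ x ∂(nullLaw n d) = ∫ y, ψ y ∂P := by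
    rw [nullLaw_eq_map, integral_map measurable_ofRows.aemeasurable hm.aestronglyMeasurable]
  have hgiven : ∀ A : Finset (Fin n), A.card = k →
      ∫ x, φ x ∂(altLawGiven n d α β A) = ∫ y, L A y * ψ y ∂P := fun A hA => by
    rw [altLawGiven_eq_map_withDensity (h.variance_eq hβ hA) (hS A),
      integral_map measurable_ofRows.aemeasurable hm.aestronglyMeasurable,
      integral_withDensity_eq_integral_toReal_smul (measurable_plantRatio A).ennreal_ofReal
        (ae_of_all _ fun _ => ENNReal.ofReal_lt_top)]
    simp only [ENNReal.toReal_ofReal (plantRatio_nonneg A _), smul_eq_mul]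
    rfl
  set M : (Fin d → Fin n → ℝ) → ℝ := fun y => subsetAvg (Fin n) k fun A => L A y with hM
  have hM1 : Integrable M P ∧ ∫ y, M y ∂P = 1 := by
    obtain ⟨e1, e2⟩ := integral_subsetAvg (P := P) (k := k) (f := L) fun A _ => hint A
    refine ⟨e1, e2.trans ?_⟩
    have : ∀ A, ∫ y, L A y ∂P = 1 := fun A => (integral_plantRatio (hS A)).2
    simp_rw [this]
    exact subsetAvg_const hkc 1
  have hLψ : ∀ A, Integrable (fun y => L A y * ψ y) P := fun A =>
    (hint A).mul_bdd hψm.aestronglyMeasurable hψb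
  have halt : ∫ x, φ x ∂(altLaw n d k α β) = ∫ y, M y * ψ y ∂P := by
    have e : ∀ y, M y * ψ y = subsetAvg (Fin n) k fun A => L A y * ψ y := fun y => by
      simp only [mul_comm _ (ψ y)]
      rw [subsetAvg_const_mul]
    simp_rw [e]
    rw [(integral_subsetAvg (P := P) (k := k) (f := fun A y => L A y * ψ y)
      fun A _ => hLψ A).2, integral_altLaw hm h0 h1]
    exact le_antisymm (subsetAvg_mono fun A hA => (hgiven A hA).le)
      (subsetAvg_mono fun A hA => (hgiven A hA).ge)
  -- the second moment of the likelihood ratio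
  have hM2 : Integrable (fun y => M y ^ 2) P ∧ ∫ y, M y ^ 2 ∂P ≤ 1 + 1 / 100 := by
    have e : ∀ y, M y ^ 2 =
        subsetAvg (Fin n) k fun A' => subsetAvg (Fin n) k fun A => L A y * L A' y := fun y => by
      have : ∀ A', subsetAvg (Fin n) k (fun A => L A y * L A' y) = M y * L A' y := fun A' => by
        simp only [mul_comm _ (L A' y)]
        rw [subsetAvg_const_mul]
      simp_rw [this]
      rw [subsetAvg_const_mul, sq]
    have hLL := integral_plantRatio_mul (d := d) hβ0 hγ0 hsm
    have i1 : ∀ A', Integrable (fun y => subsetAvg (Fin n) k fun A => L A y * L A' y) P ∧ _ :=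
      fun A' => integral_subsetAvg (f := fun A y => L A y * L A' y) fun A _ => (hLL A A').1
    obtain ⟨j1, j2⟩ := integral_subsetAvg (P := P) (k := k)
      (f := fun A' y => subsetAvg (Fin n) k fun A => L A y * L A' y) fun A' _ => (i1 A').1
    simp_rw [e]
    refine ⟨j1, j2.trans_le ?_⟩
    calc _ ≤ subsetAvg (Fin n) k (fun _ => 1 + 1 / 100) := by
          refine subsetAvg_mono fun A' hA' => ?_
          rw [(i1 A').2]
          exact (congrArg (subsetAvg (Fin n) k) (funext fun A => (hLL A A').2)).trans_le
            (h.subsetAvg_inv_sqrt_det_pow_le hβ hA')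
      _ = _ := subsetAvg_const hkc _
  have hdiff : ∫ y, ψ y ∂P - ∫ y, M y * ψ y ∂P = ∫ y, (1 - M y) * ψ y ∂P := by
    rw [← integral_sub]
    · congr 1; ext y; ring
    · exact .of_bound hψm.aestronglyMeasurable 1 hψb
    · exact hM1.1.mul_bdd hψm.aestronglyMeasurable hψb
  rw [hnull, halt, hdiff]
  -- `|t| ≤ 5 t² + 1 / 20`, at `t = M y - 1`, turns the second moment bound into an `L¹` bound
  calc |∫ y, (1 - M y) * ψ y ∂P| ≤ ∫ y, |(1 - M y) * ψ y| ∂P := abs_integral_le_integral_abs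
    _ ≤ ∫ y, (5 * (M y ^ 2 - 2 * M y + 1) + 1 / 20) ∂P := by
        refine integral_mono_of_nonneg (ae_of_all _ fun y => abs_nonneg _) ?_
          (ae_of_all _ fun y => ?_)
        · exact (((hM2.1.sub (hM1.1.const_mul 2)).add (integrable_const 1)).const_mul 5).add
            (integrable_const _)
        · have a1 : |(1 - M y) * ψ y| ≤ |1 - M y| := by
            rw [abs_mul, abs_of_nonneg (h0 _ : 0 ≤ ψ y)]
            exact mul_le_of_le_one_right (abs_nonneg _) (h1 _)
          have a2 := sq_nonneg (|1 - M y| - 1 / 10)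
          have a3 := sq_abs (1 - M y)
          dsimp only
          nlinarith
    _ = 5 * (∫ y, M y ^ 2 ∂P - 2 * 1 + 1) + 1 / 20 := by
        rw [integral_add, integral_const_mul, integral_add, integral_sub, integral_const_mul, hM1.2]
        · simp
        · exact hM2.1
        · exact hM1.1.const_mul 2
        · exact hM2.1.sub (hM1.1.const_mul 2)
        · exact integrable_const _
        · exact ((hM2.1.sub (hM1.1.const_mul 2)).add (integrable_const 1)).const_mul 5
        · exact integrable_const _
    _ ≤ 1 / 10 := by linarith [hM2.2]

end HardRegime
end Likelihood

/-! ### Contaminated data and the planted law -/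

section Contamination

lemma map_piecewise_pi {ι E : Type*} [Fintype ι] [DecidableEq ι] [MeasurableSpace E]
    (μ : Measure E) [IsProbabilityMeasure μ] (A : Finset ι) :
    ((Measure.pi fun _ : ι => μ).prod (Measure.pi fun _ : ι => μ)).map
      (fun p i => if i ∈ A then p.1 i else p.2 i) = Measure.pi fun _ : ι => μ := by
  have hm : Measurable fun (p : (ι → E) × (ι → E)) i => if i ∈ A then p.1 i else p.2 i :=
    measurable_pi_lambda _ fun i => by split_ifs <;> fun_prop
  refine (Measure.pi_eq fun s hs => ?_).symm
  rw [Measure.map_apply hm (MeasurableSet.univ_pi hs)]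
  have : (fun (p : (ι → E) × (ι → E)) i => if i ∈ A then p.1 i else p.2 i) ⁻¹' Set.univ.pi s =
      (Set.univ.pi fun i => if i ∈ A then s i else Set.univ) ×ˢ
        (Set.univ.pi fun i => if i ∈ A then Set.univ else s i) := by
    ext p
    simp only [Set.mem_preimage, Set.mem_pi, Set.mem_univ, true_imp_iff, Set.mem_prod,
      ← forall_and]
    refine forall_congr' fun i => ?_
    split_ifs <;> simp
  rw [this, Measure.prod_prod, Measure.pi_pi, Measure.pi_pi, ← Finset.prod_mul_distrib]
  refine Finset.prod_congr rfl fun i _ => ?_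
  split_ifs <;> simp

variable {n d : ℕ}

lemma iidGaussian_eq_map (μ : EuclideanSpace ℝ (Fin d)) :
    iidGaussian n μ = (nullLaw n d).map fun x i => μ + x i := by
  have hm : Measurable fun x : EuclideanSpace ℝ (Fin d) => μ + x := measurable_const_add μ
  have : IsProbabilityMeasure ((multivariateGaussian (0 : EuclideanSpace ℝ (Fin d))
      (1 : Matrix (Fin d) (Fin d) ℝ)).map fun x => μ + x) :=
    Measure.isProbabilityMeasure_map hm.aemeasurable
  rw [nullLaw, iidGaussian, iidGaussian, Measure.pi_map_pi fun _ => hm.aemeasurable]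
  congr 1
  ext1 i
  rw [multivariateGaussian_zero_one, multivariateGaussian]
  simp

lemma contaminatedLaw_eq_map (A : Finset (Fin n)) (y : Sample n d)
    (μ : EuclideanSpace ℝ (Fin d)) :
    contaminatedLaw A y μ = (nullLaw n d).map fun x i => if i ∈ A then y i else μ + x i := by
  rw [contaminatedLaw, iidGaussian_eq_map, Measure.map_map]
  · rfl
  · exact measurable_pi_lambda _ fun i => by split_ifs <;> fun_prop
  · fun_prop

/-- The dataset with the points `g i`, `i ∈ A`, planted in a shifted sample. -/
def contaminate (A : Finset (Fin n)) (g : Sample n d) (μ : EuclideanSpace ℝ (Fin d))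
    (x : Sample n d) : Sample n d :=
  fun i => if i ∈ A then g i else μ + x i

lemma measurable_contaminate (A : Finset (Fin n)) :
    Measurable fun p : (Sample n d × EuclideanSpace ℝ (Fin d)) × Sample n d =>
      contaminate A p.1.1 p.1.2 p.2 := by
  refine measurable_pi_lambda _ fun i => ?_
  unfold contaminate
  split_ifs <;> fun_prop

lemma integral_contaminatedLaw {φ : Sample n d → ℝ} (hm : Measurable φ) (A : Finset (Fin n))
    (y : Sample n d) (μ : EuclideanSpace ℝ (Fin d)) :
    ∫ x, φ x ∂(contaminatedLaw A y μ) = ∫ x, φ (contaminate A y μ x) ∂(nullLaw n d) := by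
  rw [contaminatedLaw_eq_map, integral_map _ hm.aestronglyMeasurable]
  · rfl
  · exact (measurable_pi_lambda _ fun i => by split_ifs <;> fun_prop : Measurable _).aemeasurable

/-- The mean of the uncorrupted points of the planted dataset. -/
def plantMean (β : ℝ) (A : Finset (Fin n)) (p : Sample n d × EuclideanSpace ℝ (Fin d)) :
    EuclideanSpace ℝ (Fin d) :=
  -(β • ∑ j ∈ A, p.1 j) - p.2

lemma measurable_plantMean (β : ℝ) (A : Finset (Fin n)) :
    Measurable (plantMean (d := d) β A) := by
  unfold plantMean; fun_prop

variable {φ : Sample n d → ℝ}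

lemma integrable_comp_of_bounded {Y : Type*} [MeasurableSpace Y] {P : Measure Y}
    [IsFiniteMeasure P] (hm : Measurable φ) (h0 : ∀ x, 0 ≤ φ x) (h1 : ∀ x, φ x ≤ 1)
    {f : Y → Sample n d} (hf : Measurable f) : Integrable (fun y => φ (f y)) P :=
  .of_bound (hm.comp hf).aestronglyMeasurable 1
    (ae_of_all _ fun x => by rw [Real.norm_eq_abs, abs_of_nonneg (h0 _)]; exact h1 _)

/-- An integral against standard Gaussian data, with the points indexed by `A` drawn first. -/
lemma integral_nullLaw_eq_integral_piecewise {f : Sample n d → ℝ} (hm : Measurable f)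
    (A : Finset (Fin n)) (hf : ∀ x, 0 ≤ f x) (hf1 : ∀ x, f x ≤ 1) :
    ∫ x, f x ∂(nullLaw n d) =
      ∫ g, ∫ x, f (fun i => if i ∈ A then g i else x i) ∂(nullLaw n d) ∂(nullLaw n d) := by
  have hpw : Measurable fun (p : Sample n d × Sample n d) i => if i ∈ A then p.1 i else p.2 i :=
    measurable_pi_lambda _ fun i => by split_ifs <;> fun_prop
  have hmap : ((nullLaw n d).prod (nullLaw n d)).map
      (fun p i => if i ∈ A then p.1 i else p.2 i) = nullLaw n d :=
    map_piecewise_pi (multivariateGaussian 0 1) A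
  conv_lhs => rw [← hmap]
  rw [integral_map hpw.aemeasurable hm.aestronglyMeasurable, integral_prod]
  exact integrable_comp_of_bounded hm hf hf1 hpw

lemma integral_nullLaw_eq (hm : Measurable φ) (h0 : ∀ x, 0 ≤ φ x) (h1 : ∀ x, φ x ≤ 1)
    (A : Finset (Fin n)) :
    ∫ x, φ x ∂(nullLaw n d) = ∫ g, ∫ x, φ x ∂(contaminatedLaw A g 0) ∂(nullLaw n d) := by
  rw [integral_nullLaw_eq_integral_piecewise hm A h0 h1]
  refine integral_congr_ae (ae_of_all _ fun g =>
    ((integral_contaminatedLaw hm A g 0).trans ?_).symm)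
  have : contaminate A g 0 = fun x i => if i ∈ A then g i else x i := by
    funext x i
    simp [contaminate]
  rw [this]

lemma plant_piecewise (β : ℝ) (A : Finset (Fin n)) (g x : Sample n d)
    (z : EuclideanSpace ℝ (Fin d)) :
    plant β A (fun i => if i ∈ A then g i else x i) z =
      contaminate A g (plantMean β A (g, z)) x := by
  have hsum : ∑ j ∈ A, (if j ∈ A then g j else x j) = ∑ j ∈ A, g j :=
    Finset.sum_congr rfl fun j hj => if_pos hj
  funext i
  by_cases hi : i ∈ A
  · simp only [plant, contaminate, hi, if_true]
  · simp only [plant, contaminate, hi, if_false, plantMean, hsum]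

lemma measurable_contaminate_plantMean (β : ℝ) (A : Finset (Fin n)) :
    Measurable fun p : (Sample n d × EuclideanSpace ℝ (Fin d)) × Sample n d =>
      contaminate A p.1.1 (plantMean β A p.1) p.2 :=
  (measurable_contaminate A).comp
    ((measurable_fst.fst.prodMk ((measurable_plantMean β A).comp measurable_fst)).prodMk
      measurable_snd)

lemma integrable_integral_contaminate_plantMean (hm : Measurable φ) (h0 : ∀ x, 0 ≤ φ x)
    (h1 : ∀ x, φ x ≤ 1) (β : ℝ) (A : Finset (Fin n))
    (P : Measure (Sample n d × EuclideanSpace ℝ (Fin d))) [IsProbabilityMeasure P] :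
    Integrable (fun p => ∫ x, φ (contaminate A p.1 (plantMean β A p) x) ∂(nullLaw n d)) P :=
  (integrable_comp_of_bounded (P := P.prod (nullLaw n d)) hm h0 h1
    (measurable_contaminate_plantMean β A)).integral_prod_left

lemma integral_plant_eq (hm : Measurable φ) (h0 : ∀ x, 0 ≤ φ x) (h1 : ∀ x, φ x ≤ 1)
    (β : ℝ) (A : Finset (Fin n)) (N : Measure (EuclideanSpace ℝ (Fin d)))
    [IsProbabilityMeasure N] :
    ∫ p, φ (plant β A p.1 p.2) ∂((nullLaw n d).prod N) =
      ∫ p, ∫ x, φ (contaminate A p.1 (plantMean β A p) x) ∂(nullLaw n d)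
        ∂((nullLaw n d).prod N) := by
  have e1 := integral_prod_symm (μ := nullLaw n d) (ν := N) (fun p => φ (plant β A p.1 p.2))
    (integrable_comp_of_bounded hm h0 h1 (measurable_plant β A))
  have e2 := integral_prod_symm (μ := nullLaw n d) (ν := N)
    (fun p => ∫ x, φ (contaminate A p.1 (plantMean β A p) x) ∂(nullLaw n d))
    (integrable_integral_contaminate_plantMean hm h0 h1 β A _)
  refine e1.trans (Eq.trans ?_ e2.symm)
  refine integral_congr_ae (ae_of_all _ fun z => ?_)
  have hz : Measurable fun x : Sample n d => (x, z) := measurable_id.prodMk measurable_const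
  have hφz := (hm.comp (measurable_plant β A)).comp hz
  have := integral_nullLaw_eq_integral_piecewise hφz A (fun _ => h0 _) fun _ => h1 _
  simpa only [Function.comp_apply, plant_piecewise] using this

/-- The planted law is a mixture of contaminated laws: given the corrupted points `g` and the
shift `z`, the dataset is a contaminated sample with mean `plantMean β A (g, z)`. -/
lemma integral_altLawGiven_eq (hm : Measurable φ) (h0 : ∀ x, 0 ≤ φ x) (h1 : ∀ x, φ x ≤ 1)
    (α β : ℝ) (A : Finset (Fin n)) :
    ∫ x, φ x ∂(altLawGiven n d α β A) =
      ∫ p, ∫ x, φ (contaminate A p.1 (plantMean β A p) x) ∂(nullLaw n d) ∂((nullLaw n d).prod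
        (multivariateGaussian (0 : EuclideanSpace ℝ (Fin d))
          ((α ^ 2 / (d : ℝ)) • (1 : Matrix (Fin d) (Fin d) ℝ)))) := by
  rw [altLawGiven, integral_map (measurable_plant β A).aemeasurable hm.aestronglyMeasurable]
  exact integral_plant_eq hm h0 h1 β A _

end Contamination

/-! ### The norm of the planted mean -/

section Norm

open Complex in
lemma map_linear_functional {ι : Type*} [Fintype ι] [DecidableEq ι] {β γ w : ℝ} {A : Finset ι}
    (hγ : γ = β ^ 2 * A.card + w ^ 2) :
    ((stdGaussianPi ι).prod (gaussianReal 0 1)).map (fun p => β * ∑ j ∈ A, p.1 j + w * p.2) =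
      (gaussianReal 0 1).map (fun x => √γ * x) := by
  let R : ((ι → ℝ) × ℝ) →ₗ[ℝ] ℝ :=
    { toFun := fun p => β * ∑ j ∈ A, p.1 j + w * p.2
      map_add' := fun p q => by
        simp only [Prod.fst_add, Prod.snd_add, Pi.add_apply, Finset.sum_add_distrib]
        ring
      map_smul' := fun c p => by
        simp only [Prod.smul_fst, Prod.smul_snd, Pi.smul_apply, smul_eq_mul,
          ← Finset.mul_sum, RingHom.id_apply]
        ring }
  have hR : (fun p : (ι → ℝ) × ℝ => β * ∑ j ∈ A, p.1 j + w * p.2) =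
    R.toContinuousLinearMap := rfl
  rw [hR]
  have := Measure.isProbabilityMeasure_map (μ := (stdGaussianPi ι).prod (gaussianReal 0 1))
    R.toContinuousLinearMap.continuous.measurable.aemeasurable
  have hm : Measurable fun x : ℝ => √γ * x := by fun_prop
  have := Measure.isProbabilityMeasure_map (μ := gaussianReal 0 1) hm.aemeasurable
  refine Measure.ext_of_charFun (funext fun t => ?_)
  have hγ0 : 0 ≤ γ := by
    rw [hγ]
    exact add_nonneg (mul_nonneg (sq_nonneg _) (Nat.cast_nonneg _)) (sq_nonneg _)
  rw [charFun_map_mul, charFun_gaussianReal, charFun_map_eq_charFunDual_smul, charFunDual_prod,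
    charFunDual_stdGaussianPi, charFunDual_gaussianReal, ← Complex.exp_add]
  have h1 : ∀ i, (t • R.toContinuousLinearMap).comp (.inl ℝ (ι → ℝ) ℝ) (Pi.single i 1) =
      if i ∈ A then t * β else 0 := fun i => by
    change t * (β * ∑ j ∈ A, (Pi.single i 1 : ι → ℝ) j + w * 0) = _
    have : ∑ l ∈ A, (Pi.single i 1 : ι → ℝ) l = if i ∈ A then 1 else 0 := by
      simp [Pi.single_apply]
    rw [this]
    split_ifs <;> ring
  have h2 : (t • R.toContinuousLinearMap).comp (.inr ℝ (ι → ℝ) ℝ) 1 = t * w := by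
    change t * (β * ∑ j ∈ A, (0 : ι → ℝ) j + w * 1) = _
    simp
  have h3 : ∑ i, (if i ∈ A then t * β else 0) ^ 2 = A.card * (t * β) ^ 2 := by
    simp [ite_pow, Finset.sum_ite_mem]
  simp_rw [h1, h2, h3]
  have h4 : ((√γ : ℝ) : ℂ) ^ 2 = γ := by rw [← ofReal_pow, Real.sq_sqrt hγ0]
  congr 1
  simp only [ofReal_zero, mul_zero, zero_mul, NNReal.coe_one, ofReal_one, one_mul, zero_sub,
    ofReal_mul, mul_pow, h4]
  rw [hγ]
  push_cast
  ring

lemma det_smul_one_real {d : ℕ} (c : ℝ) : (c • (1 : Matrix (Fin d) (Fin d) ℝ)).det = c ^ d := by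
  simp

/-- Exponential Chebyshev inequality for the squared norm of a standard Gaussian vector; the
tilting parameter is `(1 - c) / 2`, so `c < 1` gives the upper tail and `c > 1` the lower one. -/
lemma stdGaussianPi_real_le {d : ℕ} {c m : ℝ} (hc : 0 < c) :
    (stdGaussianPi (Fin d)).real {x | (1 - c) / 2 * m ≤ (1 - c) / 2 * (x ⬝ᵥ x)} ≤
      Real.exp (-((1 - c) / 2 * m) - d * (Real.log c / 2)) := by
  have hN : (c • (1 : Matrix (Fin d) (Fin d) ℝ)).PosDef := PosDef.one.smul hc
  obtain ⟨h1, h2⟩ := integral_exp_quadratic hN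
  have h3 := mul_meas_ge_le_integral_of_nonneg (ae_of_all _ fun x => (Real.exp_nonneg _)) h1
    (Real.exp ((1 - c) / 2 * m))
  have he : ∀ x : Fin d → ℝ, (x ⬝ᵥ x - x ⬝ᵥ ((c • (1 : Matrix (Fin d) (Fin d) ℝ)) *ᵥ x)) / 2 =
      (1 - c) / 2 * (x ⬝ᵥ x) := fun x => by
    rw [smul_mulVec, one_mulVec, dotProduct_smul, smul_eq_mul]; ring
  simp_rw [h2, he, Real.exp_le_exp, det_smul_one_real] at h3
  have h4 : (√(c ^ d))⁻¹ = Real.exp (-(d * (Real.log c / 2))) := by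
    rw [Real.sqrt_eq_rpow, ← Real.rpow_natCast, ← Real.rpow_mul hc.le, ← Real.rpow_neg hc.le,
      Real.rpow_def_of_pos hc]
    congr 1; ring
  rw [h4] at h3
  rwa [sub_eq_add_neg (-_), Real.exp_add, Real.exp_neg ((1 - c) / 2 * m), ← div_eq_inv_mul,
    le_div_iff₀' (Real.exp_pos _)]

/-- In high dimension the squared norm of a standard Gaussian vector is of the order of `d`. -/
lemma stdGaussianPi_norm_sq_mem {d : ℕ} (hd : 1000 ≤ d) :
    4 / 5 ≤ (stdGaussianPi (Fin d)).real {x | d / 2 ≤ x ⬝ᵥ x ∧ x ⬝ᵥ x ≤ 1.9 * d} := by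
  have hd' : (1000 : ℝ) ≤ d := by exact_mod_cast hd
  have hlog1 := Real.log_two_gt_d9
  have hlog2 := Real.log_two_lt_d9
  have hsmall : Real.exp (-10) ≤ 1 / 10 := by
    rw [Real.exp_neg, inv_le_comm₀ (Real.exp_pos _) (by norm_num)]
    have := Real.add_one_le_exp (10 : ℝ)
    norm_num at this ⊢
    linarith
  have h1 := (stdGaussianPi_real_le (d := d) (c := 2) (m := d / 2) (by norm_num)).trans
    ((Real.exp_le_exp.mpr (by nlinarith : _ ≤ (-10 : ℝ))).trans hsmall)
  have h2 := (stdGaussianPi_real_le (d := d) (c := 1 / 2) (m := 1.9 * d) (by norm_num)).trans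
    ((Real.exp_le_exp.mpr (by
      rw [one_div, Real.log_inv]
      nlinarith : _ ≤ (-10 : ℝ))).trans hsmall)
  have hm : MeasurableSet {x : Fin d → ℝ | d / 2 ≤ x ⬝ᵥ x ∧ x ⬝ᵥ x ≤ 1.9 * d} := by
    have : Measurable fun x : Fin d → ℝ => x ⬝ᵥ x := by fun_prop
    exact (measurableSet_le measurable_const this).inter (measurableSet_le this measurable_const)
  have hcompl : {x : Fin d → ℝ | d / 2 ≤ x ⬝ᵥ x ∧ x ⬝ᵥ x ≤ 1.9 * d}ᶜ ⊆
      {x | (1 - 2) / 2 * ((d : ℝ) / 2) ≤ (1 - 2) / 2 * (x ⬝ᵥ x)} ∪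
        {x | (1 - 1 / 2) / 2 * (1.9 * (d : ℝ)) ≤ (1 - 1 / 2) / 2 * (x ⬝ᵥ x)} := by
    intro x hx
    simp only [Set.mem_compl_iff, Set.mem_ofPred_eq, not_and_or, not_le, Set.mem_union] at hx ⊢
    rcases hx with hx | hx
    · left; linarith
    · right; linarith
  have h3 := (measureReal_mono hcompl (by finiteness)).trans
    (measureReal_union_le (μ := stdGaussianPi (Fin d)) _ _)
  rw [probReal_compl_eq_one_sub hm] at h3
  linarith

variable {n d k : ℕ} {ε α : ℝ}

lemma norm_plantMean_ofPairRows_sq (β w : ℝ) (A : Finset (Fin n))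
    (q : Fin d → (Fin n → ℝ) × ℝ) :
    ‖plantMean β A (ofPairRows w q)‖ ^ 2 =
      ∑ r, (β * ∑ j ∈ A, (q r).1 j + w * (q r).2) ^ 2 := by
  rw [EuclideanSpace.real_norm_sq_eq]
  refine Finset.sum_congr rfl fun r _ => ?_
  simp only [plantMean, ofPairRows, ofRows, PiLp.sub_apply, PiLp.neg_apply, PiLp.smul_apply,
    WithLp.ofLp_sum, Finset.sum_apply, smul_eq_mul]
  ring

/-- When the shift is drawn at the scale `√2 α`, the mean of the uncorrupted points has norm in
`[α, 2 α]` with high probability. -/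
lemma HardRegime.prob_norm_plantMean_mem (h : HardRegime n d k ε (√2 * α)) (hα : 0 < α)
    {A : Finset (Fin n)} (hA : A.card = k) {β : ℝ} (hβ : β = correlation n d ε (√2 * α)) :
    4 / 5 ≤ ((nullLaw n d).prod (multivariateGaussian (0 : EuclideanSpace ℝ (Fin d))
      (((√2 * α) ^ 2 / (d : ℝ)) • (1 : Matrix (Fin d) (Fin d) ℝ)))).real
        {p | α ≤ ‖plantMean β A p‖ ∧ ‖plantMean β A p‖ ≤ 2 * α} := by
  have hd := h.d_pos'
  have hε := h.ε_pos
  have hv : (0 : ℝ) ≤ (√2 * α) ^ 2 / d := by positivity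
  obtain ⟨hβ0, -, hlo, hhi, -⟩ := h.correlation_spec hβ
  have hα2 : (√2 * α) ^ 2 = 2 * α ^ 2 := by rw [mul_pow, Real.sq_sqrt (by norm_num)]
  set γ := 2 * β * ε with hγ
  have hγv := h.variance_eq hβ hA
  have hγlo : 2 * α ^ 2 ≤ γ * d := by
    rw [hα2, div_le_iff₀ (by positivity)] at hlo
    linarith
  have hγhi : γ * d ≤ 1.01 * (2 * α ^ 2) := by
    rw [hα2, ← mul_div_assoc, le_div_iff₀ (by positivity)] at hhi
    linarith
  have hγ0 : 0 ≤ γ := by positivity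
  have hd1000 : 1000 ≤ d := by
    have h1 : √(d : ℝ) ≤ 1 / 1000 * (√(d : ℝ) * √(d : ℝ)) := by
      rw [Real.mul_self_sqrt hd.le]
      calc √(d : ℝ) ≤ (√2 * α) ^ 2 * n := h.sqrt_le
        _ = n * (√2 * α) ^ 2 := mul_comm _ _
        _ ≤ 1 / 1000 * (d * ε) := h.n_le
        _ ≤ 1 / 1000 * (d * 1) := by gcongr; exact h.ε_le_one
        _ = _ := by ring
    have h2 : 0 < √(d : ℝ) := Real.sqrt_pos.mpr hd
    have h3 : 1000 ≤ √(d : ℝ) := by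
      by_contra hlt
      nlinarith [not_le.mp hlt]
    have h4 : (1000 : ℝ) ≤ d := by
      rw [← Real.mul_self_sqrt hd.le]; nlinarith
    exact_mod_cast h4
  have hmeas : MeasurableSet {p : Sample n d × EuclideanSpace ℝ (Fin d) |
      α ≤ ‖plantMean β A p‖ ∧ ‖plantMean β A p‖ ≤ 2 * α} := by
    have : Measurable fun p : Sample n d × EuclideanSpace ℝ (Fin d) => ‖plantMean β A p‖ :=
      (measurable_plantMean β A).norm
    exact (measurableSet_le measurable_const this).inter (measurableSet_le this measurable_const)
  have hrow : Measurable fun p : (Fin n → ℝ) × ℝ =>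
      β * ∑ j ∈ A, p.1 j + √((√2 * α) ^ 2 / d) * p.2 := by fun_prop
  have hrows : Measurable fun (q : Fin d → (Fin n → ℝ) × ℝ) r =>
      β * ∑ j ∈ A, (q r).1 j + √((√2 * α) ^ 2 / d) * (q r).2 := by fun_prop
  have hsc : Measurable fun (x : Fin d → ℝ) r => √γ * x r := by fun_prop
  have hlaw : (pairRows n d).map (fun q r =>
      β * ∑ j ∈ A, (q r).1 j + √((√2 * α) ^ 2 / d) * (q r).2) =
      (stdGaussianPi (Fin d)).map fun x r => √γ * x r := by
    have hm1 : Measurable fun x : ℝ => √γ * x := by fun_prop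
    have i1 := Measure.isProbabilityMeasure_map (μ := gaussianReal 0 1) hm1.aemeasurable
    have i2 := Measure.isProbabilityMeasure_map
      (μ := (stdGaussianPi (Fin n)).prod (gaussianReal 0 1)) hrow.aemeasurable
    rw [pairRows, Measure.pi_map_pi (fun _ => hrow.aemeasurable)]
    conv_rhs => rw [stdGaussianPi, Measure.pi_map_pi (fun _ => hm1.aemeasurable)]
    congr 1
    ext1 r
    exact map_linear_functional hγv
  set B : Set (Fin d → ℝ) := {x | α ^ 2 ≤ ∑ r, x r ^ 2 ∧ ∑ r, x r ^ 2 ≤ 4 * α ^ 2} with hB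
  have hBm : MeasurableSet B := by
    have : Measurable fun x : Fin d → ℝ => ∑ r, x r ^ 2 := by fun_prop
    exact (measurableSet_le measurable_const this).inter (measurableSet_le this measurable_const)
  have hpre : ofPairRows √((√2 * α) ^ 2 / d) ⁻¹' {p : Sample n d × EuclideanSpace ℝ (Fin d) |
      α ≤ ‖plantMean β A p‖ ∧ ‖plantMean β A p‖ ≤ 2 * α} =
      (fun (q : Fin d → (Fin n → ℝ) × ℝ) r =>
        β * ∑ j ∈ A, (q r).1 j + √((√2 * α) ^ 2 / d) * (q r).2) ⁻¹' B := by
    ext q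
    simp only [Set.mem_preimage, Set.mem_ofPred_eq, hB, ← norm_plantMean_ofPairRows_sq]
    rw [sq_le_sq₀ hα.le (norm_nonneg _), show 4 * α ^ 2 = (2 * α) ^ 2 by ring,
      sq_le_sq₀ (norm_nonneg _) (by positivity)]
  rw [nullLaw_prod_eq_map n d hv, map_measureReal_apply (measurable_ofPairRows _) hmeas, hpre,
    ← map_measureReal_apply hrows hBm, hlaw, map_measureReal_apply hsc hBm]
  refine (stdGaussianPi_norm_sq_mem hd1000).trans (measureReal_mono ?_ (by finiteness))
  rintro x ⟨hx1, hx2⟩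
  have hsum : ∑ r, (√γ * x r) ^ 2 = γ * (x ⬝ᵥ x) := by
    simp_rw [mul_pow, Real.sq_sqrt hγ0, ← Finset.mul_sum, dotProduct, sq]
  have e1 : γ * (d / 2) ≤ γ * (x ⬝ᵥ x) := by gcongr
  have e2 : γ * (x ⬝ᵥ x) ≤ γ * (1.9 * d) := by gcongr
  simp only [Set.mem_preimage, hB, Set.mem_ofPred_eq, hsum]
  constructor
  · linarith
  · linarith [sq_nonneg α]

/-- If the parameters are in the hard regime at the scale `√2 α`, there is no robust tester for
the distance `α`. -/
lemma HardRegime.not_isRobustMeanTester (h : HardRegime n d k ε (√2 * α)) (hα : 0 < α)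
    (φ : Sample n d → ℝ) : ¬ IsRobustMeanTester n d k α (2 / 3) φ := by
  intro hφ
  have hm := hφ.measurable
  set β := correlation n d ε (√2 * α) with hβ
  have hkc : k ≤ Fintype.card (Fin n) := by rw [Fintype.card_fin]; exact h.k_le
  have hTV := abs_le.mp (h.abs_integral_altLaw_sub_le hm hφ.nonneg hφ.le_one)
  obtain ⟨A, -, hA⟩ := Finset.exists_subset_card_eq (s := (Finset.univ : Finset (Fin n)))
    (n := k) (by rw [Finset.card_univ]; exact hkc)
  have hnull : 2 / 3 ≤ ∫ x, (1 - φ x) ∂(nullLaw n d) := by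
    have hm1 : Measurable fun x => 1 - φ x := by fun_prop
    have h0 : ∀ x, 0 ≤ 1 - φ x := fun x => by linarith [hφ.le_one x]
    have h1 : ∀ x, 1 - φ x ≤ 1 := fun x => by linarith [hφ.nonneg x]
    rw [integral_nullLaw_eq hm1 h0 h1 A]
    have hint : Integrable (fun g => ∫ x, (1 - φ x) ∂(contaminatedLaw A g 0)) (nullLaw n d) := by
      simp_rw [integral_contaminatedLaw hm1]
      have hc : Measurable fun p : Sample n d × Sample n d => contaminate A p.1 0 p.2 :=
        (measurable_contaminate A).comp
          ((measurable_fst.prodMk measurable_const).prodMk measurable_snd)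
      exact (integrable_comp_of_bounded (P := (nullLaw n d).prod (nullLaw n d))
        hm1 h0 h1 hc).integral_prod_left
    calc (2 / 3 : ℝ) = ∫ _g, (2 / 3 : ℝ) ∂(nullLaw n d) := by simp
      _ ≤ _ := integral_mono (integrable_const _) hint fun g => hφ.accept A g hA
  have hnull' : ∫ x, φ x ∂(nullLaw n d) ≤ 1 / 3 := by
    have hi : Integrable φ (nullLaw n d) :=
      integrable_comp_of_bounded hm hφ.nonneg hφ.le_one measurable_id
    rw [integral_sub (integrable_const _) hi] at hnull
    simp only [integral_const, probReal_univ, smul_eq_mul, mul_one] at hnull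
    linarith
  have halt : 2 / 3 * (4 / 5) ≤ ∫ x, φ x ∂(altLaw n d k (√2 * α) β) := by
    rw [integral_altLaw hm hφ.nonneg hφ.le_one, ← subsetAvg_const hkc (2 / 3 * (4 / 5) : ℝ)]
    refine subsetAvg_mono fun A hA => ?_
    rw [integral_altLawGiven_eq hm hφ.nonneg hφ.le_one]
    set P := (nullLaw n d).prod (multivariateGaussian (0 : EuclideanSpace ℝ (Fin d))
      (((√2 * α) ^ 2 / (d : ℝ)) • (1 : Matrix (Fin d) (Fin d) ℝ)))
    set G := {p : Sample n d × EuclideanSpace ℝ (Fin d) |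
      α ≤ ‖plantMean β A p‖ ∧ ‖plantMean β A p‖ ≤ 2 * α} with hG
    have hGm : MeasurableSet G := by
      have : Measurable fun p : Sample n d × EuclideanSpace ℝ (Fin d) => ‖plantMean β A p‖ :=
        (measurable_plantMean β A).norm
      exact (measurableSet_le measurable_const this).inter (measurableSet_le this measurable_const)
    have hprob : 4 / 5 ≤ P.real G := h.prob_norm_plantMean_mem hα hA hβ
    calc (2 / 3 * (4 / 5) : ℝ) ≤ 2 / 3 * P.real G := by gcongr
      _ = ∫ p, G.indicator (fun _ => (2 / 3 : ℝ)) p ∂P := by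
        rw [integral_indicator_const _ hGm, smul_eq_mul, mul_comm]
      _ ≤ _ := by
        refine integral_mono ((integrable_const _).indicator hGm)
          (integrable_integral_contaminate_plantMean hm hφ.nonneg hφ.le_one β A P) fun p => ?_
        by_cases hp : p ∈ G
        · rw [Set.indicator_of_mem hp]
          have := hφ.reject A p.1 _ hA hp.1 hp.2
          rwa [integral_contaminatedLaw hm] at this
        · rw [Set.indicator_of_notMem hp]
          exact integral_nonneg fun x => hφ.nonneg _
  linarith [hTV.1]

end Norm

/-! ### Conclusion -/

/-- The hypotheses on the sample size put the parameters in the hard regime, at the scale `α` as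
well as at scales `a` up to `√2 α`. -/
lemma hardRegime_of_bounds {n d k : ℕ} {ε α a : ℝ} (hd : 0 < d) (hε : 0 < ε) (hε1 : ε ≤ 1)
    (hα : 0 < α) (ha : 0 < a) (hαa : α ^ 2 ≤ a ^ 2) (haα : a ^ 2 ≤ 2 * α ^ 2)
    (hk : (k : ℝ) = ε * n)
    (hlow : √(d : ℝ) / α ^ 2 + (d : ℝ) * ε ^ 3 / α ^ 4 ≤ n)
    (hup : (n : ℝ) ≤ 1 / 4000 * min
      ((d : ℝ) ^ (2 / 3 : ℝ) * ε ^ (2 / 3 : ℝ) / α ^ (8 / 3 : ℝ)) ((d : ℝ) * ε / α ^ 2)) :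
    HardRegime n d k ε a := by
  have hd' : (0 : ℝ) < d := by exact_mod_cast hd
  have hn : (0 : ℝ) ≤ n := Nat.cast_nonneg n
  have ha4 : α ^ 4 ≤ a ^ 4 := by
    calc α ^ 4 = (α ^ 2) ^ 2 := by ring
      _ ≤ (a ^ 2) ^ 2 := by gcongr
      _ = a ^ 4 := by ring
  have ha8 : a ^ 8 ≤ 16 * α ^ 8 := by
    calc a ^ 8 = (a ^ 2) ^ 4 := by ring
      _ ≤ (2 * α ^ 2) ^ 4 := by gcongr
      _ = 16 * α ^ 8 := by ring
  have h1 : 0 ≤ √(d : ℝ) / α ^ 2 := by positivity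
  have h2 : 0 ≤ (d : ℝ) * ε ^ 3 / α ^ 4 := by positivity
  have hY : (n : ℝ) ≤ 1 / 4000 * (d * ε / α ^ 2) := hup.trans (by gcongr; exact min_le_right _ _)
  have hX : (n : ℝ) ≤ 1 / 4000 *
      ((d : ℝ) ^ (2 / 3 : ℝ) * ε ^ (2 / 3 : ℝ) / α ^ (8 / 3 : ℝ)) :=
    hup.trans (by gcongr; exact min_le_left _ _)
  refine ⟨hd, hε, hε1, ha, hk, ?_, ?_, ?_, ?_⟩
  · have : √(d : ℝ) / α ^ 2 ≤ n := by linarith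
    rw [div_le_iff₀ (by positivity), mul_comm] at this
    exact this.trans (by gcongr)
  · have : (d : ℝ) * ε ^ 3 / α ^ 4 ≤ n := by linarith
    rw [div_le_iff₀ (by positivity), mul_comm (n : ℝ)] at this
    exact this.trans (by gcongr)
  · -- the fractional powers disappear after cubing
    have hcube : ∀ (x : ℝ) (p : ℝ) (m : ℕ), 0 ≤ x → p * 3 = m → (x ^ p) ^ 3 = x ^ m :=
      fun x p m hx hp => by
        rw [← Real.rpow_natCast (x ^ p) 3, ← Real.rpow_mul hx]
        push_cast
        rw [hp, Real.rpow_natCast]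
    have h3 : (n : ℝ) ^ 3 ≤ (1 / 4000) ^ 3 * (d ^ 2 * ε ^ 2 / α ^ 8) := by
      calc (n : ℝ) ^ 3 ≤ (1 / 4000 *
            ((d : ℝ) ^ (2 / 3 : ℝ) * ε ^ (2 / 3 : ℝ) / α ^ (8 / 3 : ℝ))) ^ 3 := by gcongr
        _ = _ := by
          rw [mul_pow (1 / 4000 : ℝ), div_pow (_ * _), mul_pow (_ ^ _ : ℝ),
            hcube d _ 2 hd'.le (by norm_num),
            hcube ε _ 2 hε.le (by norm_num), hcube α _ 8 hα.le (by norm_num)]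
    calc (n : ℝ) ^ 3 * a ^ 8 ≤
        ((1 / 4000) ^ 3 * (d ^ 2 * ε ^ 2 / α ^ 8)) * (16 * α ^ 8) := by gcongr
      _ = 16 * (1 / 4000) ^ 3 * (d * ε) ^ 2 := by field_simp
      _ ≤ (1 / 20000) ^ 2 * (d * ε) ^ 2 := by gcongr; norm_num
      _ = _ := by ring
  · calc (n : ℝ) * a ^ 2 ≤ (1 / 4000 * (d * ε / α ^ 2)) * (2 * α ^ 2) := by gcongr
      _ = 1 / 2000 * (d * ε) := by field_simp; norm_num
      _ ≤ 1 / 1000 * (d * ε) := by gcongr; norm_num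

/-- The total variation distance is bounded by the largest advantage of a test. -/
lemma tvDist_le_of_forall_test {Ω : Type*} [MeasurableSpace Ω] {P Q : Measure Ω} {c : ℝ}
    (h : ∀ φ : Ω → ℝ, Measurable φ → (∀ x, 0 ≤ φ x) → (∀ x, φ x ≤ 1) →
      |∫ x, φ x ∂P - ∫ x, φ x ∂Q| ≤ c) : tvDist P Q ≤ c := by
  have : Nonempty {s : Set Ω // MeasurableSet s} := ⟨⟨∅, MeasurableSet.empty⟩⟩
  refine ciSup_le fun s => ?_
  have := h (s.1.indicator fun _ => 1) (measurable_const.indicator s.2)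
    (fun x => Set.indicator_nonneg (fun _ _ => zero_le_one) x)
    (fun x => Set.indicator_le_self' (fun _ _ => zero_le_one) x)
  rwa [integral_indicator_const _ s.2, integral_indicator_const _ s.2, smul_eq_mul, smul_eq_mul,
    mul_one, mul_one] at this

end ObliviousMeanTesting

end

theorem mainTheorem2 :
    ∃ c : ℝ, 0 < c ∧
      ∀ (n d k : ℕ) (ε α : ℝ), 0 < d → 0 < ε → ε ≤ α → α ≤ 1 →
        (k : ℝ) = ε * (n : ℝ) →
        Real.sqrt (d : ℝ) / α ^ 2 + (d : ℝ) * ε ^ 3 / α ^ 4 ≤ (n : ℝ) →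
        (n : ℝ) ≤ c * min
          ((d : ℝ) ^ (2 / 3 : ℝ) * ε ^ (2 / 3 : ℝ) / α ^ (8 / 3 : ℝ))
          ((d : ℝ) * ε / α ^ 2) →
        ObliviousMeanTesting.tvDist
            (ObliviousMeanTesting.nullLaw n d)
            (ObliviousMeanTesting.altLaw n d k α
              (ObliviousMeanTesting.correlation n d ε α)) ≤ 1 / 10 ∧
          ¬ ∃ φ : ObliviousMeanTesting.Sample n d → ℝ,
            ObliviousMeanTesting.IsRobustMeanTester n d k α (2 / 3) φ := by
  -- the constant leaves room for replacing `α` by `√2 α`, see `hardRegime_of_bounds`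
  refine ⟨1 / 4000, by norm_num, fun n d k ε α hd hε hεα hα1 hk hlow hup => ?_⟩
  have hα : 0 < α := hε.trans_le hεα
  have hε1 : ε ≤ 1 := hεα.trans hα1
  have h2 : (√2 * α) ^ 2 = 2 * α ^ 2 := by rw [mul_pow, Real.sq_sqrt (by norm_num)]
  have hsq := sq_nonneg α
  constructor
  · have h : ObliviousMeanTesting.HardRegime n d k ε α :=
      ObliviousMeanTesting.hardRegime_of_bounds hd hε hε1 hα hα le_rfl (by linarith) hk hlow hup
    exact ObliviousMeanTesting.tvDist_le_of_forall_test fun φ hm h0 h1 =>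
      h.abs_integral_altLaw_sub_le hm h0 h1
  · rintro ⟨φ, hφ⟩
    have h : ObliviousMeanTesting.HardRegime n d k ε (√2 * α) :=
      ObliviousMeanTesting.hardRegime_of_bounds hd hε hε1 hα (by positivity)
        (by rw [h2]; linarith) h2.le hk hlow hup
    exact h.not_isRobustMeanTester hα φ hφ
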